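/- Let $f_1\colon \widehat{\mathbb C}\to\widehat{\mathbb C}$ be the rational map of the Riemann sphere given by $$f_1(z)=\frac{2\left(z^2-\tfrac34\right)^3}{z^2\left(z^2-\tfrac98\right)^2}-1 .$$ Let $\operatorname{post}(f_1)=\bigcup_{n\ge 1} f_1^{n}(\operatorname{crit}(f_1))$ be its postcritical set, where $\operatorname{crit}(f_1)$ is the set of points near which $f_1$ is not injective, and let $t\in\widehat{\mathbb C}\setminus\operatorname{post}(f_1)$ be any basepoint. A loop $\gamma$ at $t$ in $\widehat{\mathbb C}\setminus\operatorname{post}(f_1)$ acts on the dynamical preimage tree $\bigsqcup_{n\ge 0} f_1^{-n}(t)$ by sending $p\in f_1^{-n}(t)$ to the endpoint of the $f_1^n$-lift of $\gamma$ that starts at $p$. The iterated monodromy group $\operatorname{IMG}(f_1)$ is the quotient of $\pi_1(\widehat{\mathbb C}\setminus\operatorname{post}(f_1),t)$ by the kernel of this action, that is, the group of permutations of the tree induced by such loops. Then for every $n\in\mathbb N$ the group $\operatorname{IMG}(f_1)$ contains a subgroup isomorphic to $\mathbb Z^n$. -/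

import Mathlib

open scoped OnePoint

noncomputable section

/-- The critical points of a self-map `f`: the points near which `f` is not injective. For a
branched covering, written locally as `z ↦ z ^ d`, these are the points of local degree `d ≥ 2`. -/
def criticalSet {X : Type*} [TopologicalSpace X] (f : X → X) : Set X :=
  {x | ¬ ∃ U ∈ nhds x, Set.InjOn f U}

/-- The postcritical set `⋃_{n ≥ 1} fⁿ(crit f)`. -/
def postcriticalSet {X : Type*} [TopologicalSpace X] (f : X → X) : Set X :=
  ⋃ n : ℕ, f^[n + 1] '' criticalSet f

/-- The vertex set of the dynamical preimage tree of `f` at `t`: the formal disjoint union of the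
levels `f⁻ⁿ(t)`, `n ≥ 0`; the pair `(n, p)` is the vertex `p` of level `n`. -/
abbrev PreimageTree {X : Type*} (f : X → X) (t : X) : Type _ :=
  {v : ℕ × X // f^[v.1] v.2 = t}

/-- The permutation `g` of the preimage tree is the monodromy action of the loop `γ`: it preserves
levels, and each vertex `p` of level `n` is carried to the endpoint of the lift of `γ`
by `fⁿ` that starts at `p`. -/
def IsMonodromyOf {X : Type*} [TopologicalSpace X] (f : X → X) {t : X} (γ : Path t t)
    (g : Equiv.Perm (PreimageTree f t)) : Prop :=
  ∀ v : PreimageTree f t, (g v).1.1 = v.1.1 ∧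
    ∃ δ : Path v.1.2 (g v).1.2, ∀ s, f^[v.1.1] (δ s) = γ s

/-- The iterated monodromy group of `f` with basepoint `t ∉ post f`: the group of all permutations
of the preimage tree that are induced by loops at `t` in the complement of `post f`, that is, the
image of the fundamental group of that complement under the iterated monodromy action, which is
the quotient of the fundamental group by the kernel of the action.
(With the left-to-right concatenation of loops the action is a right action, so the product
`g * h` of permutations is induced by the loop of `h` followed by the loop of `g`.) -/
def IMG {X : Type*} [TopologicalSpace X] (f : X → X) (t : X) (ht : t ∉ postcriticalSet f) :
    Subgroup (Equiv.Perm (PreimageTree f t)) where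
  carrier := {g | ∃ γ : Path t t, (∀ s, γ s ∉ postcriticalSet f) ∧ IsMonodromyOf f γ g}
  one_mem' :=
    ⟨Path.refl t, fun _ => ht, fun v => ⟨rfl, Path.refl _, fun _ => v.2⟩⟩
  mul_mem' := by
    rintro g h ⟨γ, hγ, hg⟩ ⟨η, hη, hh⟩
    refine ⟨η.trans γ, fun s => ?_, fun v => ?_⟩
    · rw [Path.trans_apply]
      split_ifs
      · exact hη _
      · exact hγ _
    · obtain ⟨e₁, δ₁, h₁⟩ := hh v
      obtain ⟨e₂, δ₂, h₂⟩ := hg (h v)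
      refine ⟨e₂.trans e₁, δ₁.trans δ₂, fun s => ?_⟩
      change f^[v.1.1] ((δ₁.trans δ₂) s) = (η.trans γ) s
      rw [Path.trans_apply, Path.trans_apply]
      split_ifs
      · exact h₁ _
      · rw [← e₁]
        exact h₂ _
  inv_mem' := by
    rintro g ⟨γ, hγ, hg⟩
    refine ⟨γ.symm, fun s => hγ _, fun v => ?_⟩
    obtain ⟨w, rfl⟩ := g.surjective v
    obtain ⟨e, δ, hδ⟩ := hg w
    have hw : g⁻¹ (g w) = w := Equiv.symm_apply_apply g w
    rw [hw]
    exact ⟨e.symm, δ.symm, fun s => by rw [e]; exact hδ _⟩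

/-- The rational map `f₁(z) = 2 (z² - 3/4)³ / (z² (z² - 9/8)²) - 1` on the Riemann sphere. -/
def f₁ : OnePoint ℂ → OnePoint ℂ
  | ∞ => ((1 : ℂ) : OnePoint ℂ)
  | (z : ℂ) =>
    open Classical in
    if z ^ 2 * (z ^ 2 - 9 / 8) ^ 2 = 0 then ∞
    else ((2 * (z ^ 2 - 3 / 4) ^ 3 / (z ^ 2 * (z ^ 2 - 9 / 8) ^ 2) - 1 : ℂ) : OnePoint ℂ)

end

/-! The postcritical set is `{1, -1, ∞}`. It lies on the extended real line, and `f₁` has real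
coefficients. Over either closed half-plane without these points, the iterated inverse branches are
continuous and stay in such half-planes, so the preimage tree is labelled by words in six letters.
Crossing one of the three real intervals changes the labels by an explicit finite automaton, the
involution `reflection e`. A loop that crosses the line twice induces a product of two reflections,
so the IMG contains a copy of `rotationGroup` (`rotationGroup_le_comap_IMG`); only this inclusion is
needed.

The rest is group theory. Write a, b, c for `rotA`, `rotB`, `rotC`, the rotations about -1, 1, ∞;
then b = ac and a³ = c² = b²⁴ = 1. Elements acting below different letters commute, so ℤⁿ⁺¹ is found
in `rigidGroup m` by placing an element of infinite order below `(true, 1)` and a copy of ℤⁿ from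
`rigidGroup (m + 1)` below `(true, 0)` (`exists_free_abelian`). This requires elements of infinite
order in the groups `rigidGroup (m + 1)` for all m.

The key fact is b¹² ∈ `rigidGroup 1` (`rotB_pow_twelve_mem`). On the one hand b¹² acts as c below
`(true, 0)`; on the other it is a product of conjugates of c. By induction, commutators with c send
`rigidGroup (m + 1)` into `rigidGroup (m + 2)` (`commutator_rotC_mem`). The element `rotG` = (cb¹²)²
is inverted by c, so its commutators with c are its own even powers, and `rotG ^ 2 ^ m` lies in
`rigidGroup (m + 1)`. It has infinite order because cb¹² moves `(true, 2)` while its square acts as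
cb¹² itself below that letter. -/

noncomputable section

/-! ### The automaton generated by the three reflections -/

/-- A letter `(s, k)` names the inverse branch `± hₖ` of `f₁`, the sign being given by `s`. -/
abbrev Letter := Bool × Fin 3

/-- The inverse branch on the other side of the edge `e`: the edges `0`, `1`, `2` are the
intervals `(-∞, -1)`, `(-1, 1)`, `(1, ∞)`. -/
def edgeLetter : Fin 3 → Letter → Letter
  | 0, (s, 0) => (s, 0)
  | 0, (s, 1) => (!s, 2)
  | 0, (s, 2) => (!s, 1)
  | 1, (s, 0) => (!s, 1)
  | 1, (s, 1) => (!s, 0)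
  | 1, (s, 2) => (s, 2)
  | 2, (s, 0) => (!s, 0)
  | 2, (s, 1) => (s, 1)
  | 2, (s, 2) => (s, 2)

/-- The edge that an inverse branch maps the edge `e` to, if its image is real. -/
def edgeSection : Fin 3 → Letter → Option (Fin 3)
  | 0, (_, 0) => some 1
  | 1, (_, 2) => some 1
  | 2, (true, 1) => some 0
  | 2, (true, 2) => some 2
  | 2, (false, 1) => some 2
  | 2, (false, 2) => some 0
  | _, _ => none

/-- The change of labels of the preimage tree when the edge `e` is crossed. -/
def crossEdge : Fin 3 → List Letter → List Letter
  | _, [] => []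
  | e, x :: w => edgeLetter e x ::
      match edgeSection e x with
      | none => w
      | some e' => crossEdge e' w

theorem edgeLetter_edgeLetter (e : Fin 3) (x : Letter) :
    edgeLetter e (edgeLetter e x) = x := by
  revert e x; decide

theorem edgeSection_edgeLetter (e : Fin 3) (x : Letter) :
    edgeSection e (edgeLetter e x) = edgeSection e x := by
  revert e x; decide

theorem crossEdge_involutive (e : Fin 3) : Function.Involutive (crossEdge e) := by
  intro l
  induction l generalizing e with
  | nil => rfl
  | cons x w ih =>
    simp only [crossEdge, edgeLetter_edgeLetter, edgeSection_edgeLetter]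
    cases edgeSection e x with
    | none => rfl
    | some e' => simp only [ih]

/-- The crossing of the edge `e` as a permutation of words. -/
def reflection (e : Fin 3) : Equiv.Perm (List Letter) := (crossEdge_involutive e).toPerm

theorem reflection_apply (e : Fin 3) (l : List Letter) : reflection e l = crossEdge e l := rfl

theorem reflection_mul_self (e : Fin 3) : reflection e * reflection e = 1 :=
  Equiv.ext (crossEdge_involutive e)

theorem reflection_inv (e : Fin 3) : (reflection e)⁻¹ = reflection e :=
  inv_eq_of_mul_eq_one_left (reflection_mul_self e)

/-- `p` carries the subtree below `x` to the subtree below `y`, acting there as `s`. -/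
def HasSection (p : Equiv.Perm (List Letter)) (x y : Letter) (s : Equiv.Perm (List Letter)) :
    Prop :=
  ∀ w, p (x :: w) = y :: s w

theorem HasSection.mul {p q s t : Equiv.Perm (List Letter)} {x y z : Letter}
    (hq : HasSection q y z t) (hp : HasSection p x y s) : HasSection (q * p) x z (t * s) := by
  intro w
  rw [Equiv.Perm.mul_apply, hp, hq, Equiv.Perm.mul_apply]

theorem HasSection.congr {p s t : Equiv.Perm (List Letter)} {x y : Letter}
    (hp : HasSection p x y s) (h : s = t) : HasSection p x y t := h ▸ hp

theorem hasSection_one (x : Letter) : HasSection 1 x x 1 := fun _ => rfl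

theorem HasSection.inv {p s : Equiv.Perm (List Letter)} {x y : Letter}
    (hp : HasSection p x y s) : HasSection p⁻¹ y x s⁻¹ := by
  intro w
  rw [Equiv.Perm.inv_eq_iff_eq, hp]
  simp

theorem HasSection.pow {p s : Equiv.Perm (List Letter)} {x : Letter}
    (hp : HasSection p x x s) (n : ℕ) : HasSection (p ^ n) x x (s ^ n) := by
  induction n with
  | zero => exact hasSection_one x
  | succ n ih => rw [pow_succ, pow_succ]; exact ih.mul hp

theorem hasSection_reflection_none {e : Fin 3} {x y : Letter} (hy : edgeLetter e x = y)
    (h : edgeSection e x = none) : HasSection (reflection e) x y 1 := by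
  intro w
  simp [reflection_apply, crossEdge, h, hy]

theorem hasSection_reflection_some {e e' : Fin 3} {x y : Letter} (hy : edgeLetter e x = y)
    (h : edgeSection e x = some e') : HasSection (reflection e) x y (reflection e') := by
  intro w
  simp [reflection_apply, crossEdge, h, hy]

theorem ext_of_hasSection {p q : Equiv.Perm (List Letter)} (h0 : p [] = q [])
    (h : ∀ x, ∃ y s, HasSection p x y s ∧ HasSection q x y s) : p = q := by
  ext1 l
  cases l with
  | nil => exact h0
  | cons x w =>
    obtain ⟨y, s, hp, hq⟩ := h x
    rw [hp, hq]

/-- Extension of a permutation of words to the subtree below `x`, by the identity elsewhere. -/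
def below (x : Letter) : Equiv.Perm (List Letter) →* Equiv.Perm (List Letter) where
  toFun h :=
    { toFun := fun l => match l with
        | [] => []
        | y :: w => if y = x then y :: h w else y :: w
      invFun := fun l => match l with
        | [] => []
        | y :: w => if y = x then y :: h⁻¹ w else y :: w
      left_inv := by
        rintro (_ | ⟨y, w⟩)
        · rfl
        · by_cases hy : y = x <;> simp [hy]
      right_inv := by
        rintro (_ | ⟨y, w⟩)
        · rfl
        · by_cases hy : y = x <;> simp [hy] }
  map_one' := by
    ext1 l
    rcases l with _ | ⟨y, w⟩
    · rfl
    · simp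
  map_mul' g h := by
    ext1 l
    rcases l with _ | ⟨y, w⟩
    · rfl
    · by_cases hy : y = x <;> simp [hy]

theorem hasSection_below (x : Letter) (h : Equiv.Perm (List Letter)) :
    HasSection (below x h) x x h := by
  intro w
  simp [below]

theorem hasSection_below_of_ne {x y : Letter} (hy : y ≠ x) (h : Equiv.Perm (List Letter)) :
    HasSection (below x h) y y 1 := by
  intro w
  simp [below, hy]

theorem below_commute {x y : Letter} (hxy : x ≠ y) (g h : Equiv.Perm (List Letter)) :
    below x g * below y h = below y h * below x g := by
  refine ext_of_hasSection rfl fun u => ?_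
  by_cases hx : u = x
  · subst hx
    exact ⟨u, g, by simpa using (hasSection_below u g).mul (hasSection_below_of_ne hxy h),
      by simpa using (hasSection_below_of_ne hxy h).mul (hasSection_below u g)⟩
  by_cases hy : u = y
  · subst hy
    exact ⟨u, h, by simpa using (hasSection_below_of_ne hx g).mul (hasSection_below u h),
      by simpa using (hasSection_below u h).mul (hasSection_below_of_ne hx g)⟩
  · exact ⟨u, 1, by simpa using (hasSection_below_of_ne hx g).mul (hasSection_below_of_ne hy h),
      by simpa using (hasSection_below_of_ne hy h).mul (hasSection_below_of_ne hx g)⟩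

/-- This is the tool that moves an element supported on one subtree to another subtree. -/
theorem HasSection.conj_below {p s : Equiv.Perm (List Letter)} {x y : Letter}
    (hp : HasSection p x y s) (h : Equiv.Perm (List Letter)) :
    p * below x h * p⁻¹ = below y (s * h * s⁻¹) := by
  rw [mul_inv_eq_iff_eq_mul]
  ext1 l
  by_cases hl : ∃ w, l = x :: w
  · obtain ⟨w, rfl⟩ := hl
    rw [(hp.mul (hasSection_below x h)) w, ((hasSection_below y _).mul hp) w]
    simp
  · have h1 : below x h l = l := by
      rcases l with _ | ⟨u, w⟩
      · rfl
      · exact hasSection_below_of_ne (fun hu => hl ⟨w, by rw [hu]⟩) h w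
    rw [Equiv.Perm.mul_apply, h1, Equiv.Perm.mul_apply]
    rcases hpl : p l with _ | ⟨u, w⟩
    · rfl
    · refine (hasSection_below_of_ne (fun hu => hl ⟨s⁻¹ w, p.injective ?_⟩) _ w).symm
      simp [hpl, hp _, hu]

/-! ### The reflection group and its branching subgroups -/

/-- The group generated by the three reflections. -/
def reflectionGroup : Subgroup (Equiv.Perm (List Letter)) :=
  Subgroup.closure (Set.range reflection)

/-- The group generated by the products of two reflections. -/
def rotationGroup : Subgroup (Equiv.Perm (List Letter)) :=
  Subgroup.closure {p | ∃ e e', p = reflection e * reflection e'}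

theorem reflection_mem (e : Fin 3) : reflection e ∈ reflectionGroup :=
  Subgroup.subset_closure ⟨e, rfl⟩

theorem rotation_mem (e e' : Fin 3) : reflection e * reflection e' ∈ rotationGroup :=
  Subgroup.subset_closure ⟨e, e', rfl⟩

theorem rotationGroup_le : rotationGroup ≤ reflectionGroup := by
  refine (Subgroup.closure_le _).2 ?_
  rintro _ ⟨e, e', rfl⟩
  exact mul_mem (reflection_mem e) (reflection_mem e')

/-- A subgroup is normalized by the reflection group if this holds for the generators. -/
theorem conj_mem_of_reflection {H : Subgroup (Equiv.Perm (List Letter))}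
    (hH : ∀ e, ∀ h ∈ H, reflection e * h * (reflection e)⁻¹ ∈ H)
    {g h : Equiv.Perm (List Letter)} (hg : g ∈ reflectionGroup) (hh : h ∈ H) :
    g * h * g⁻¹ ∈ H := by
  induction hg using Subgroup.closure_induction'' generalizing h with
  | mem x hx => obtain ⟨e, rfl⟩ := hx; exact hH e h hh
  | inv_mem x hx =>
    obtain ⟨e, rfl⟩ := hx
    rw [reflection_inv]
    exact hH e h hh
  | one => simpa using hh
  | mul x y _ _ ihx ihy =>
    have := ihx (ihy hh)
    simpa [mul_assoc] using this

theorem rotationGroup_conj {g h : Equiv.Perm (List Letter)} (hg : g ∈ reflectionGroup)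
    (hh : h ∈ rotationGroup) : g * h * g⁻¹ ∈ rotationGroup := by
  refine conj_mem_of_reflection (fun e h hh => ?_) hg hh
  induction hh using Subgroup.closure_induction with
  | mem x hx =>
    obtain ⟨e₁, e₂, rfl⟩ := hx
    rw [reflection_inv]
    simpa [mul_assoc] using mul_mem (rotation_mem e e₁) (rotation_mem e₂ e)
  | one => simp
  | mul x y _ _ hx hy => simpa [mul_assoc] using mul_mem hx hy
  | inv x _ hx => simpa [mul_assoc] using inv_mem hx

/-- Self-replication at `(true, 0)`. Sections of rotations can be single reflections, so the
statement is about the full reflection group. -/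
theorem exists_hasSection {g : Equiv.Perm (List Letter)} (hg : g ∈ reflectionGroup) :
    ∃ p ∈ reflectionGroup, HasSection p (true, 0) (true, 0) g := by
  induction hg using Subgroup.closure_induction with
  | mem x hx =>
    obtain ⟨e, rfl⟩ := hx
    have m := reflection_mem
    fin_cases e
    -- The word carries `(true, 0)` to `(true, 1)`, where `reflection 2` has section `reflection 0`,
    -- and returns by the same route; the other steps have trivial sections.
    · refine ⟨reflection 2 * (reflection 1 * (reflection 2 * (reflection 1 * reflection 2))),
        mul_mem (m _) (mul_mem (m _) (mul_mem (m _) (mul_mem (m _) (m _)))), ?_⟩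
      have h1 : HasSection (reflection 2) (true, 0) (false, 0) 1 :=
        hasSection_reflection_none rfl rfl
      have h2 : HasSection (reflection 1) (false, 0) (true, 1) 1 :=
        hasSection_reflection_none rfl rfl
      have h3 : HasSection (reflection 2) (true, 1) (true, 1) (reflection 0) :=
        hasSection_reflection_some rfl rfl
      have h4 : HasSection (reflection 1) (true, 1) (false, 0) 1 :=
        hasSection_reflection_none rfl rfl
      have h5 : HasSection (reflection 2) (false, 0) (true, 0) 1 :=
        hasSection_reflection_none rfl rfl
      simpa using h5.mul (h4.mul (h3.mul (h2.mul h1)))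
    · exact ⟨reflection 0, m _, hasSection_reflection_some rfl rfl⟩
    · refine ⟨reflection 1 * (reflection 0 * (reflection 2 * (reflection 0 * reflection 1))),
        mul_mem (m _) (mul_mem (m _) (mul_mem (m _) (mul_mem (m _) (m _)))), ?_⟩
      have h1 : HasSection (reflection 1) (true, 0) (false, 1) 1 :=
        hasSection_reflection_none rfl rfl
      have h2 : HasSection (reflection 0) (false, 1) (true, 2) 1 :=
        hasSection_reflection_none rfl rfl
      have h3 : HasSection (reflection 2) (true, 2) (true, 2) (reflection 2) :=
        hasSection_reflection_some rfl rfl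
      have h4 : HasSection (reflection 0) (true, 2) (false, 1) 1 :=
        hasSection_reflection_none rfl rfl
      have h5 : HasSection (reflection 1) (false, 1) (true, 0) 1 :=
        hasSection_reflection_none rfl rfl
      simpa using h5.mul (h4.mul (h3.mul (h2.mul h1)))
  | one => exact ⟨1, one_mem _, hasSection_one _⟩
  | mul x y _ _ hx hy =>
    obtain ⟨p, hp, hp'⟩ := hx
    obtain ⟨q, hq, hq'⟩ := hy
    exact ⟨p * q, mul_mem hp hq, hp'.mul hq'⟩
  | inv x _ hx =>
    obtain ⟨p, hp, hp'⟩ := hx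
    exact ⟨p⁻¹, inv_mem hp, hp'.inv⟩

/-- The permutations that give rotations when moved `m` times below the letter `(true, 0)`. -/
def rigidGroup : ℕ → Subgroup (Equiv.Perm (List Letter))
  | 0 => rotationGroup
  | m + 1 => (rigidGroup m).comap (below (true, 0))

theorem mem_rigidGroup_succ {m : ℕ} {h : Equiv.Perm (List Letter)} :
    h ∈ rigidGroup (m + 1) ↔ below (true, 0) h ∈ rigidGroup m := Iff.rfl

/-- An element with section `g` at `(true, 0)` turns conjugation by `g` below that letter into
conjugation one level up. -/
theorem rigidGroup_conj {m : ℕ} {g h : Equiv.Perm (List Letter)} (hg : g ∈ reflectionGroup)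
    (hh : h ∈ rigidGroup m) : g * h * g⁻¹ ∈ rigidGroup m := by
  induction m generalizing g h with
  | zero => exact rotationGroup_conj hg hh
  | succ m ih =>
    obtain ⟨p, hp, hs⟩ := exists_hasSection hg
    rw [mem_rigidGroup_succ, ← hs.conj_below]
    exact ih hp hh

/-- The rotation about the fixed point `1` of `f₁`. -/
def rotB : Equiv.Perm (List Letter) := reflection 1 * reflection 2

/-- The rotation about `∞`. -/
def rotC : Equiv.Perm (List Letter) := reflection 2 * reflection 0

/-- The rotation about `-1`. -/
def rotA : Equiv.Perm (List Letter) := reflection 1 * reflection 0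

/-! ### Orders and sections of the rotations about the postcritical points -/

theorem rotA_mem : rotA ∈ rotationGroup := rotation_mem _ _
theorem rotB_mem : rotB ∈ rotationGroup := rotation_mem _ _
theorem rotC_mem : rotC ∈ rotationGroup := rotation_mem _ _

/-- All poles of `f₁` are double and none is postcritical, so the square has only trivial sections.
-/
theorem rotC_mul_self : rotC * rotC = 1 := by
  have A1 : ∀ s, HasSection (reflection 0) (s, 0) (s, 0) (reflection 1) :=
    fun s => hasSection_reflection_some rfl rfl
  have A2 : ∀ s, HasSection (reflection 0) (s, 1) (!s, 2) 1 := by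
    intro s; cases s <;> exact hasSection_reflection_none rfl rfl
  have A3 : ∀ s, HasSection (reflection 0) (s, 2) (!s, 1) 1 := by
    intro s; cases s <;> exact hasSection_reflection_none rfl rfl
  have C1 : ∀ s, HasSection (reflection 2) (s, 0) (!s, 0) 1 := by
    intro s; cases s <;> exact hasSection_reflection_none rfl rfl
  have C2 : ∀ s, HasSection (reflection 2) (s, 1) (s, 1) (reflection (bif s then 0 else 2)) := by
    intro s; cases s <;> exact hasSection_reflection_some rfl rfl
  have C3 : ∀ s, HasSection (reflection 2) (s, 2) (s, 2) (reflection (bif s then 2 else 0)) := by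
    intro s; cases s <;> exact hasSection_reflection_some rfl rfl
  refine ext_of_hasSection rfl fun x => ⟨x, 1, ?_, hasSection_one x⟩
  obtain ⟨s, k⟩ := x
  fin_cases k
  · have h := ((C1 (!s)).mul (A1 (!s))).mul ((C1 s).mul (A1 s))
    rw [Bool.not_not] at h
    exact h.congr (by simp [reflection_mul_self])
  · have h := ((C2 (!!s)).mul (A3 (!s))).mul ((C3 (!s)).mul (A2 s))
    rw [Bool.not_not] at h
    cases s <;> exact h.congr (by simp [reflection_mul_self])
  · have h := ((C3 (!!s)).mul (A2 (!s))).mul ((C2 (!s)).mul (A3 s))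
    rw [Bool.not_not] at h
    cases s <;> exact h.congr (by simp [reflection_mul_self])

/-- Both preimages of -1 are triple and neither is postcritical. -/
theorem rotA_pow_three : rotA ^ 3 = 1 := by
  have A1 : ∀ s, HasSection (reflection 0) (s, 0) (s, 0) (reflection 1) :=
    fun s => hasSection_reflection_some rfl rfl
  have A2 : ∀ s, HasSection (reflection 0) (s, 1) (!s, 2) 1 := by
    intro s; cases s <;> exact hasSection_reflection_none rfl rfl
  have A3 : ∀ s, HasSection (reflection 0) (s, 2) (!s, 1) 1 := by
    intro s; cases s <;> exact hasSection_reflection_none rfl rfl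
  have B1 : ∀ s, HasSection (reflection 1) (s, 0) (!s, 1) 1 := by
    intro s; cases s <;> exact hasSection_reflection_none rfl rfl
  have B2 : ∀ s, HasSection (reflection 1) (s, 1) (!s, 0) 1 := by
    intro s; cases s <;> exact hasSection_reflection_none rfl rfl
  have B3 : ∀ s, HasSection (reflection 1) (s, 2) (s, 2) (reflection 1) :=
    fun s => hasSection_reflection_some rfl rfl
  have h0 : ∀ s, HasSection rotA (s, 0) (!s, 1) (reflection 1) := fun s =>
    ((B1 s).mul (A1 s)).congr (by simp)
  have h1 : ∀ s, HasSection rotA (s, 1) (!s, 2) (reflection 1) := fun s =>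
    ((B3 (!s)).mul (A2 s)).congr (by simp)
  have h2 : ∀ s, HasSection rotA (s, 2) (s, 0) 1 := fun s => by
    have h := (B2 (!s)).mul (A3 s)
    rw [Bool.not_not] at h
    exact h
  refine ext_of_hasSection rfl fun x => ⟨x, 1, ?_, hasSection_one x⟩
  obtain ⟨s, k⟩ := x
  rw [pow_succ, sq]
  fin_cases k
  · simpa [reflection_mul_self] using ((h2 _).mul (h1 _)).mul (h0 s)
  · simpa [reflection_mul_self] using ((h0 _).mul (h2 _)).mul (h1 s)
  · simpa [reflection_mul_self] using ((h1 _).mul (h0 _)).mul (h2 s)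

theorem hasSection_rotB : HasSection rotB (true, 2) (true, 2) rotB :=
  (hasSection_reflection_some rfl rfl).mul (hasSection_reflection_some rfl rfl)

theorem hasSection_rotB' : HasSection rotB (false, 2) (false, 2) rotA :=
  (hasSection_reflection_some rfl rfl).mul (hasSection_reflection_some rfl rfl)

/-- Over 1 the point ∞ has local degree 4: the four letters with index 0 or 1 form one cycle, and
the return map is the rotation about ∞. The simple preimages 1 and -1 account for the letters with
index 2. -/
theorem hasSection_rotB_pow_four (s : Bool) {k : Fin 3} (hk : k ≠ 2) :
    HasSection (rotB ^ 4) (s, k) (s, k) rotC := by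
  have h1 : HasSection rotB (true, 0) (true, 1) 1 :=
    ((hasSection_reflection_none (e := 1) (x := (false, 0)) rfl rfl).mul
      (hasSection_reflection_none (e := 2) (x := (true, 0)) rfl rfl)).congr (by simp)
  have h2 : HasSection rotB (true, 1) (false, 0) (reflection 0) :=
    ((hasSection_reflection_none (e := 1) (x := (true, 1)) rfl rfl).mul
      (hasSection_reflection_some (e := 2) (x := (true, 1)) rfl rfl)).congr (by simp)
  have h3 : HasSection rotB (false, 0) (false, 1) 1 :=
    ((hasSection_reflection_none (e := 1) (x := (true, 0)) rfl rfl).mul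
      (hasSection_reflection_none (e := 2) (x := (false, 0)) rfl rfl)).congr (by simp)
  have h4 : HasSection rotB (false, 1) (true, 0) (reflection 2) :=
    ((hasSection_reflection_none (e := 1) (x := (false, 1)) rfl rfl).mul
      (hasSection_reflection_some (e := 2) (x := (false, 1)) rfl rfl)).congr (by simp)
  have hC : reflection 0 * reflection 2 = rotC := by
    rw [← mul_left_cancel_iff (a := rotC), rotC_mul_self]
    simp only [rotC, mul_assoc]
    rw [← mul_assoc (reflection 0), reflection_mul_self, one_mul, reflection_mul_self]
  have hp : rotB ^ 4 = rotB * (rotB * (rotB * rotB)) := by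
    simp only [pow_succ, pow_zero, one_mul, mul_assoc]
  rw [hp]
  have hk' : k = 0 ∨ k = 1 := by revert hk; revert k; decide
  rcases hk' with rfl | rfl <;> cases s
  · simpa [hC] using h2.mul (h1.mul (h4.mul h3))
  · simpa [rotC] using h4.mul (h3.mul (h2.mul h1))
  · simpa [hC] using h3.mul (h2.mul (h1.mul h4))
  · simpa [rotC] using h1.mul (h4.mul (h3.mul h2))

/-- The exponent 8 kills the order-two part over ∞ and leaves `rotA ^ 8 = rotA⁻¹` over -1. -/
theorem rotB_pow_eight : rotB ^ 8 = below (true, 2) (rotB ^ 8) * below (false, 2) rotA⁻¹ := by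
  have hA : rotA ^ 8 = rotA⁻¹ := by
    rw [eq_inv_iff_mul_eq_one, ← pow_succ, show 8 + 1 = 3 * 3 from rfl, pow_mul, rotA_pow_three,
      one_pow]
  have hC : rotC ^ 2 = 1 := by rw [sq, rotC_mul_self]
  refine ext_of_hasSection rfl fun x => ?_
  obtain ⟨s, k⟩ := x
  by_cases hk : k = 2
  · subst hk
    cases s
    · exact ⟨(false, 2), rotA ^ 8, hasSection_rotB'.pow 8,
        ((hasSection_below_of_ne (x := (true, 2)) (by decide) (rotB ^ 8)).mul
          (hasSection_below (false, 2) rotA⁻¹)).congr (by simp [hA])⟩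
    · exact ⟨(true, 2), rotB ^ 8, hasSection_rotB.pow 8,
        ((hasSection_below (true, 2) (rotB ^ 8)).mul
          (hasSection_below_of_ne (x := (false, 2)) (by decide) rotA⁻¹)).congr (by simp)⟩
  · refine ⟨(s, k), 1, ?_, ?_⟩
    · rw [← hC, show 8 = 4 * 2 from rfl, pow_mul]
      exact (hasSection_rotB_pow_four s hk).pow 2
    · have hne : ∀ s', (s, k) ≠ (s', 2) := fun s' h => hk (congrArg Prod.snd h)
      exact ((hasSection_below_of_ne (hne true) (rotB ^ 8)).mul
        (hasSection_below_of_ne (hne false) rotA⁻¹)).congr (by simp)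

theorem rotB_pow_twelve_mul_self : rotB ^ 12 * rotB ^ 12 = 1 := by
  rw [← pow_add]
  have key : ∀ l : List Letter, (rotB ^ 24) l = l := by
    intro l
    induction l with
    | nil => rfl
    | cons x w ih =>
      obtain ⟨s, k⟩ := x
      by_cases hk : k = 2
      · subst hk
        cases s
        · have h := hasSection_rotB'.pow 24
          rw [show 24 = 3 * 8 from rfl, pow_mul rotA, rotA_pow_three, one_pow] at h
          exact h w
        · rw [(hasSection_rotB.pow 24) w, ih]
      · have h := (hasSection_rotB_pow_four s hk).pow 6
        rw [← pow_mul, show 6 = 2 * 3 from rfl, pow_mul rotC, sq, rotC_mul_self, one_pow] at h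
        exact h w
  exact Equiv.ext key

theorem commutator_mem_rigidGroup :
    rotA * rotB ^ 3 * rotA⁻¹ * (rotB ^ 3)⁻¹ ∈ rigidGroup 1 := by
  have m := reflection_mem
  -- `k` exchanges `(true, 2)` and `(false, 2)` with trivial sections. The conjugate `e` below
  -- therefore has sections `rotA ^ 3 = 1` and `rotB ^ 3` there, so commuting it with `rotB ^ 8`
  -- cancels the part below `(true, 2)`.
  set k := reflection 0 * (reflection 1 * (reflection 2 * (reflection 1 * reflection 0))) with hk
  have hkm : k ∈ reflectionGroup :=
    mul_mem (m _) (mul_mem (m _) (mul_mem (m _) (mul_mem (m _) (m _))))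
  have r (e : Fin 3) (x : Letter) (h : edgeSection e x = none) :
      HasSection (reflection e) x (edgeLetter e x) 1 := hasSection_reflection_none rfl h
  have k1 : HasSection k (true, 2) (false, 2) 1 :=
    ((r 0 (true, 1) rfl).mul ((r 1 (false, 0) rfl).mul ((r 2 (true, 0) rfl).mul
      ((r 1 (false, 1) rfl).mul (r 0 (true, 2) rfl))))).congr (by simp)
  have k2 : HasSection k (false, 2) (true, 2) 1 :=
    ((r 0 (false, 1) rfl).mul ((r 1 (true, 0) rfl).mul ((r 2 (false, 0) rfl).mul
      ((r 1 (true, 1) rfl).mul (r 0 (false, 2) rfl))))).congr (by simp)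
  set e := k * rotB ^ 3 * k⁻¹ with he
  have e1 : HasSection e (true, 2) (true, 2) 1 := by
    have h := (k2.mul (hasSection_rotB'.pow 3)).mul k2.inv
    simpa [rotA_pow_three] using h
  have e2 : HasSection e (false, 2) (false, 2) (rotB ^ 3) := by
    have h := (k1.mul (hasSection_rotB.pow 3)).mul k1.inv
    simpa using h
  have hem : e ∈ rotationGroup := rotationGroup_conj hkm (pow_mem rotB_mem 3)
  have hd : rotB ^ 8 ∈ rotationGroup := pow_mem rotB_mem 8
  have hcomm : (rotB ^ 8)⁻¹ * (e * rotB ^ 8 * e⁻¹) =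
      below (false, 2) (rotA * rotB ^ 3 * rotA⁻¹ * (rotB ^ 3)⁻¹) := by
    have h1 : e * rotB ^ 8 * e⁻¹ =
        below (true, 2) (rotB ^ 8) * below (false, 2) (rotB ^ 3 * rotA⁻¹ * (rotB ^ 3)⁻¹) := by
      have h2 := e1.conj_below (rotB ^ 8)
      have h3 := e2.conj_below rotA⁻¹
      rw [one_mul, inv_one, mul_one] at h2
      have h4 : e * rotB ^ 8 * e⁻¹ = (e * below (true, 2) (rotB ^ 8) * e⁻¹) *
          (e * below (false, 2) rotA⁻¹ * e⁻¹) := by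
        conv_lhs => rw [rotB_pow_eight]
        simp only [mul_assoc, inv_mul_cancel_left]
      rw [h4, h2, h3]
    rw [h1]
    nth_rewrite 1 [rotB_pow_eight]
    rw [mul_inv_rev, mul_assoc, inv_mul_cancel_left, ← map_inv, ← map_mul]
    simp [mul_assoc]
  have hmem := mul_mem (inv_mem hd) (mul_mem (mul_mem hem hd) (inv_mem hem))
  rw [hcomm] at hmem
  -- The commutator is supported below `(false, 2)`; conjugation moves it below `(true, 0)`
  -- unchanged.
  have ht : HasSection (reflection 2 * (reflection 1 * reflection 0)) (false, 2) (true, 0) 1 :=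
    ((r 2 (false, 0) rfl).mul ((r 1 (true, 1) rfl).mul (r 0 (false, 2) rfl))).congr (by simp)
  have h := rotationGroup_conj (mul_mem (m 2) (mul_mem (m 1) (m 0))) hmem
  rw [ht.conj_below] at h
  simpa [mem_rigidGroup_succ, rigidGroup] using h

/-- In a quotient of the modular group in which the cube of the parabolic generator is central,
its twelfth power is trivial. -/
theorem pow_twelve_eq_one_of_commute {G : Type*} [Group G] {a c : G} (ha : a ^ 3 = 1)
    (hc : c * c = 1) (hz : Commute a ((a * c) ^ 3)) : (a * c) ^ 12 = 1 := by
  set ζ := (a * c) ^ 3 with hζ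
  have hzc : Commute c ζ := by
    have h : Commute (a⁻¹ * (a * c)) ζ := hz.inv_left.mul_left (Commute.self_pow _ _)
    simpa using h
  have ha' : a * a * a = 1 := by rw [← ha, pow_succ, sq]
  have hci : c⁻¹ = c := inv_eq_of_mul_eq_one_left hc
  have hai : a⁻¹ = a * a := inv_eq_of_mul_eq_one_left ha'
  have hu : c * (a * c * a⁻¹) = ζ * (a⁻¹ * c * a) := by
    have h1 : ζ = a⁻¹ * ζ * a := by rw [mul_assoc, ← hz.eq]; group
    rw [h1, hζ, pow_succ, sq]
    simp only [mul_assoc]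
    have hac : ∀ x, a⁻¹ * (a * x) = x := fun x => inv_mul_cancel_left a x
    have hca : ∀ x, a * (a⁻¹ * x) = x := fun x => mul_inv_cancel_left a x
    have hcc : ∀ x, c * (c * x) = x := fun x => by rw [← mul_assoc, hc, one_mul]
    have haaa : a * a = a⁻¹ := hai.symm
    simp only [hac, hca, hcc]
    rw [haaa]
  have hv : (a⁻¹ * c * a) * (a⁻¹ * c * a) = 1 := by
    have : (a⁻¹ * c * a) * (a⁻¹ * c * a) = a⁻¹ * (c * c) * a := by group
    rw [this, hc]; group
  have hw : (a * c * a⁻¹) * (a * c * a⁻¹) = 1 := by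
    have : (a * c * a⁻¹) * (a * c * a⁻¹) = a * (c * c) * a⁻¹ := by group
    rw [this, hc]; group
  set v := a⁻¹ * c * a with hvd
  set w := a * c * a⁻¹ with hwd
  have hzv : Commute v ζ := (hz.inv_left.mul_left hzc).mul_left hz
  have hsq : (c * w) * (c * w) = ζ * ζ := by
    rw [hu]
    calc ζ * v * (ζ * v) = ζ * (v * ζ) * v := by group
      _ = ζ * (ζ * v) * v := by rw [hzv.eq]
      _ = ζ * ζ * (v * v) := by group
      _ = ζ * ζ := by rw [hv, mul_one]
  have hsq' : (w * c) * (w * c) = ζ * ζ := by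
    have h1 : (w * c) * (w * c) = c * ((c * w) * (c * w)) * c := by
      calc (w * c) * (w * c) = (c * c) * (w * c) * (w * c) := by rw [hc, one_mul]
        _ = c * ((c * w) * (c * w)) * c := by group
    rw [h1, hsq, (hzc.mul_right hzc).eq, mul_assoc, hc, mul_one]
  -- `w * c` is inverse to `c * w` because both factors are involutions, yet both products have
  -- square `ζ * ζ`.
  have h4 : (ζ * ζ) * (ζ * ζ) = 1 := by
    nth_rewrite 1 [← hsq]
    rw [← hsq']
    calc c * w * (c * w) * (w * c * (w * c)) = c * w * (c * (w * w) * c) * (w * c) := by group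
      _ = 1 := by rw [hw, mul_one, hc, mul_one, mul_assoc, ← mul_assoc w, hw, one_mul, hc]
  calc (a * c) ^ 12 = ((a * c) ^ 3) ^ 4 := by rw [← pow_mul]
    _ = (ζ * ζ) * (ζ * ζ) := by rw [← hζ]; simp only [pow_succ, pow_zero, one_mul, mul_assoc]
    _ = 1 := h4

theorem rotB_eq : rotB = rotA * rotC := by
  have hC : rotC = reflection 0 * reflection 2 := by
    have h := eq_inv_of_mul_eq_one_left rotC_mul_self
    rw [h, rotC, mul_inv_rev, reflection_inv, reflection_inv]
  rw [hC, rotA, rotB, mul_assoc, ← mul_assoc (reflection 0), reflection_mul_self, one_mul]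

/-- Modulo `rigidGroup 1` the element `rotB ^ 3` commutes with `rotA`, so the relation in quotients
of the modular group applies. -/
theorem rotB_pow_twelve_mem : rotB ^ 12 ∈ rigidGroup 1 := by
  let N : Subgroup reflectionGroup := (rigidGroup 1).subgroupOf reflectionGroup
  have : N.Normal := ⟨fun n hn g => by
    exact rigidGroup_conj (m := 1) g.2 hn⟩
  let a : reflectionGroup := ⟨rotA, rotationGroup_le rotA_mem⟩
  let c : reflectionGroup := ⟨rotC, rotationGroup_le rotC_mem⟩
  have hb : ∀ n, (((a * c) ^ n : reflectionGroup) : Equiv.Perm (List Letter)) = rotB ^ n := by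
    intro n; simp [a, c, rotB_eq]
  have h := pow_twelve_eq_one_of_commute (a := (a : reflectionGroup ⧸ N)) (c := c)
    (by
      rw [← QuotientGroup.mk_pow]
      have : a ^ 3 = 1 := Subtype.ext rotA_pow_three
      rw [this]; rfl)
    (by
      rw [← QuotientGroup.mk_mul]
      have : c * c = 1 := Subtype.ext rotC_mul_self
      rw [this]; rfl)
    (by
      change (a : reflectionGroup ⧸ N) * ((a : reflectionGroup ⧸ N) * c) ^ 3 = _
      rw [← mul_inv_eq_one, mul_inv_rev, ← mul_assoc, ← QuotientGroup.mk_mul,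
        ← QuotientGroup.mk_pow, ← QuotientGroup.mk_mul, ← QuotientGroup.mk_inv,
        ← QuotientGroup.mk_inv, ← QuotientGroup.mk_mul, ← QuotientGroup.mk_mul,
        QuotientGroup.eq_one_iff, Subgroup.mem_subgroupOf]
      have := commutator_mem_rigidGroup
      simpa [hb, a] using this)
  rw [← QuotientGroup.mk_mul, ← QuotientGroup.mk_pow, QuotientGroup.eq_one_iff,
    Subgroup.mem_subgroupOf, hb] at h
  exact h

theorem hasSection_rotB_pow_twelve (s : Bool) {k : Fin 3} (hk : k ≠ 2) :
    HasSection (rotB ^ 12) (s, k) (s, k) rotC := by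
  have h := (hasSection_rotB_pow_four s hk).pow 3
  rwa [← pow_mul, pow_succ rotC, sq, rotC_mul_self, one_mul] at h

/-- Since `rotB ^ 12` is a product of conjugates of `rotC`, a bound for commutators with `rotC`
extends to it. -/
theorem commutator_rotB_mem {H H' : Subgroup (Equiv.Perm (List Letter))}
    (hH : ∀ g ∈ reflectionGroup, ∀ h ∈ H, g * h * g⁻¹ ∈ H)
    (hH' : ∀ g ∈ reflectionGroup, ∀ h ∈ H', g * h * g⁻¹ ∈ H')
    (hc : ∀ h ∈ H, rotC * h * rotC⁻¹ * h⁻¹ ∈ H') :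
    ∀ h ∈ H, rotB ^ 12 * h * (rotB ^ 12)⁻¹ * h⁻¹ ∈ H' := by
  have hmul : ∀ x ∈ reflectionGroup, ∀ y, (∀ h ∈ H, x * h * x⁻¹ * h⁻¹ ∈ H') →
      (∀ h ∈ H, y * h * y⁻¹ * h⁻¹ ∈ H') → ∀ h ∈ H, (x * y) * h * (x * y)⁻¹ * h⁻¹ ∈ H' := by
    intro x hx y h1 h2 h hh
    have := mul_mem (hH' x hx _ (h2 h hh)) (h1 h hh)
    convert this using 1
    group
  have hconj : ∀ x ∈ reflectionGroup, ∀ y, (∀ h ∈ H, y * h * y⁻¹ * h⁻¹ ∈ H') →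
      ∀ h ∈ H, (x * y * x⁻¹) * h * (x * y * x⁻¹)⁻¹ * h⁻¹ ∈ H' := by
    intro x hx y h1 h hh
    have := hH' x hx _ (h1 _ (hH x⁻¹ (inv_mem hx) h hh))
    convert this using 1
    group
  have ha := rotationGroup_le rotA_mem
  have hcm := rotationGroup_le rotC_mem
  -- Expand (ac)³ and collect the powers of a to the left of each c, using a³ = 1.
  have e3 : rotB ^ 3 = (rotA * rotC * rotA⁻¹) * ((rotA ^ 2 * rotC * (rotA ^ 2)⁻¹) * rotC) := by
    have h3 : (rotA ^ 2)⁻¹ = rotA := by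
      rw [inv_eq_iff_mul_eq_one, ← pow_succ, rotA_pow_three]
    rw [h3, rotB_eq]
    simp only [pow_succ, pow_zero, one_mul, mul_assoc, inv_mul_cancel_left]
  have h3m := mul_mem (mul_mem (mul_mem ha hcm) (inv_mem ha))
    (mul_mem (mul_mem (mul_mem (pow_mem ha 2) hcm) (inv_mem (pow_mem ha 2))) hcm)
  have h3 := hmul _ (mul_mem (mul_mem ha hcm) (inv_mem ha)) _ (hconj _ ha _ hc)
    (hmul _ (mul_mem (mul_mem (pow_mem ha 2) hcm) (inv_mem (pow_mem ha 2))) _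
      (hconj _ (pow_mem ha 2) _ hc) hc)
  rw [← e3] at h3 h3m
  have h6 := hmul _ h3m _ h3 h3
  have h12 := hmul _ (mul_mem h3m h3m) _ h6 h6
  have e12 : rotB ^ 12 = rotB ^ 3 * rotB ^ 3 * (rotB ^ 3 * rotB ^ 3) := by
    simp only [← pow_add]
  rwa [e12]

/-- Below `(true, 0)` the commutator with `rotC` becomes, one level up, the commutator with `rotB ^
12`, where the induction hypothesis applies; products of conjugates then bring `rotC` back to `rotB
^ 12`. -/
theorem commutator_mem_rigidGroup_succ (m : ℕ) :
    ∀ h ∈ rigidGroup m, rotB ^ 12 * h * (rotB ^ 12)⁻¹ * h⁻¹ ∈ rigidGroup (m + 1) := by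
  induction m with
  | zero =>
    intro h hh
    have h1 := mul_mem rotB_pow_twelve_mem
      (rigidGroup_conj (rotationGroup_le hh) (inv_mem rotB_pow_twelve_mem))
    simpa [mul_assoc] using h1
  | succ m ih =>
    refine commutator_rotB_mem (fun g hg h hh => rigidGroup_conj hg hh)
      (fun g hg h hh => rigidGroup_conj hg hh) fun h hh => ?_
    rw [mem_rigidGroup_succ, map_mul,
      ← (hasSection_rotB_pow_twelve true (k := 0) (by decide)).conj_below, map_inv]
    exact ih _ hh

theorem commutator_rotC_mem (m : ℕ) {h : Equiv.Perm (List Letter)} (hh : h ∈ rigidGroup (m + 1)) :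
    rotC * h * rotC⁻¹ * h⁻¹ ∈ rigidGroup (m + 2) := by
  rw [mem_rigidGroup_succ, map_mul,
    ← (hasSection_rotB_pow_twelve true (k := 0) (by decide)).conj_below, map_inv]
  exact commutator_mem_rigidGroup_succ m _ hh

/-- A rotation of infinite order that has a power in each of the groups `rigidGroup m`. -/
def rotG : Equiv.Perm (List Letter) := (rotC * rotB ^ 12) * (rotC * rotB ^ 12)

/-! ### Elements of infinite order and free abelian subgroups -/

theorem rotC_inv : rotC⁻¹ = rotC := inv_eq_of_mul_eq_one_left rotC_mul_self

theorem rotC_conj_rotG : rotC * rotG * rotC⁻¹ = rotG⁻¹ := by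
  have hz : (rotB ^ 12)⁻¹ = rotB ^ 12 := inv_eq_of_mul_eq_one_left rotB_pow_twelve_mul_self
  rw [rotG, mul_inv_rev, mul_inv_rev, hz, rotC_inv]
  simp only [mul_assoc]
  rw [← mul_assoc rotC rotC, rotC_mul_self, one_mul]

/-- Since `rotC` inverts `rotG`, the commutator of `rotC` with a power of `rotG` is the inverse
square of that power: each doubling of the exponent gains one level. -/
theorem rotG_pow_mem (m : ℕ) : rotG ^ 2 ^ m ∈ rigidGroup (m + 1) := by
  induction m with
  | zero =>
    have h := mul_mem (rigidGroup_conj (rotationGroup_le rotC_mem) rotB_pow_twelve_mem)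
      rotB_pow_twelve_mem
    rw [rotC_inv] at h
    simpa [rotG, mul_assoc] using h
  | succ m ih =>
    have h := inv_mem (commutator_rotC_mem m ih)
    have h1 : rotC * rotG ^ 2 ^ m * rotC⁻¹ = (rotG ^ 2 ^ m)⁻¹ := by
      rw [← conj_pow, rotC_conj_rotG, inv_pow]
    rw [h1, mul_inv_rev, inv_inv, ← pow_add] at h
    rwa [pow_succ, mul_two]

/-- With p = `rotC * rotB ^ 12`, a trivial even power of p has a trivial section, which is the half
power of p at `(true, 2)`; odd powers of p move `(true, 2)` to `(false, 1)`. Descent on the exponent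
excludes torsion. -/
theorem rotG_zpow_injective : Function.Injective (fun k : ℤ => rotG ^ k) := by
  set p := rotC * rotB ^ 12 with hp
  have h1 : HasSection p (true, 2) (false, 1) (reflection 2 * rotB ^ 12) := by
    have hc : HasSection rotC (true, 2) (false, 1) (reflection 2 * 1) :=
      (hasSection_reflection_some rfl rfl).mul (hasSection_reflection_none rfl rfl)
    simpa using hc.mul (hasSection_rotB.pow 12)
  have h2 : HasSection p (false, 1) (true, 2) (reflection 2 * rotC) := by
    have hc : HasSection rotC (false, 1) (true, 2) (reflection 2 * 1) :=
      (hasSection_reflection_some rfl rfl).mul (hasSection_reflection_none rfl rfl)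
    simpa using hc.mul (hasSection_rotB_pow_twelve false (k := 1) (by decide))
  have h3 : HasSection (p ^ 2) (true, 2) (true, 2) p := by
    have h := h2.mul h1
    have e : reflection 2 * rotC * (reflection 2 * rotB ^ 12) = p := by
      have : reflection 2 * rotC * reflection 2 = rotC := by
        nth_rewrite 2 [← rotC_inv]
        rw [rotC, mul_inv_rev, reflection_inv, reflection_inv, ← mul_assoc, reflection_mul_self,
          one_mul]
      rw [← mul_assoc, this]
    rwa [e, ← sq] at h
  have hpow : ∀ n : ℕ, 0 < n → p ^ n ≠ 1 := by
    intro n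
    induction n using Nat.strong_induction_on with
    | _ n ih =>
      intro hn h
      rcases Nat.even_or_odd' n with ⟨k, rfl | rfl⟩
      · refine ih k (by omega) (by omega) (Equiv.ext fun w => ?_)
        have := h3.pow k w
        rw [← pow_mul, h] at this
        simpa using this.symm
      · have h4 := (h1.mul (h3.pow k)) []
        rw [← pow_mul, ← pow_succ', h] at h4
        simp at h4
  have hg : ¬ IsOfFinOrder rotG := by
    rw [isOfFinOrder_iff_pow_eq_one]
    rintro ⟨n, hn, h⟩
    refine hpow (2 * n) (by omega) ?_
    rwa [pow_mul, sq]
  exact injective_zpow_iff_not_isOfFinOrder.2 hg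

theorem exists_free_abelian (n : ℕ) : ∀ m, ∃ φ : Multiplicative (Fin n → ℤ) →*
    Equiv.Perm (List Letter), Function.Injective φ ∧ ∀ k, φ k ∈ rigidGroup m := by
  induction n with
  | zero => exact fun m => ⟨1, fun x y _ => Subsingleton.elim _ _, fun _ => one_mem _⟩
  | succ n ih =>
    intro m
    obtain ⟨φ, hφ, hm⟩ := ih (m + 1)
    let g := rotG ^ 2 ^ m
    have hcomm : ∀ p q, below (true, 1) p * below (true, 0) q =
        below (true, 0) q * below (true, 1) p := fun p q => below_commute (by decide) p q
    let ψ : Multiplicative (Fin (n + 1) → ℤ) →* Equiv.Perm (List Letter) :=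
      { toFun := fun k => below (true, 1) (g ^ (k.toAdd 0)) *
          below (true, 0) (φ (Multiplicative.ofAdd fun i => k.toAdd i.succ))
        map_one' := by
          have : (Multiplicative.ofAdd fun _ => 0 : Multiplicative (Fin n → ℤ)) = 1 := rfl
          simp [this]
        map_mul' := by
          intro k l
          have e : (Multiplicative.ofAdd fun i : Fin n => (k * l).toAdd i.succ) =
            (Multiplicative.ofAdd fun i => k.toAdd i.succ) *
              (Multiplicative.ofAdd fun i => l.toAdd i.succ) := rfl
          rw [e, map_mul φ, map_mul (below (true, 0)), toAdd_mul, Pi.add_apply, zpow_add,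
            map_mul (below (true, 1))]
          simp only [mul_assoc]
          rw [← mul_assoc (below (true, 1) (g ^ (l.toAdd 0))), hcomm, mul_assoc] }
    refine ⟨ψ, (injective_iff_map_eq_one _).2 fun k hk => ?_, fun k => ?_⟩
    · have h1 : g ^ (k.toAdd 0) = 1 := Equiv.ext fun w => by
        have h := ((hasSection_below (true, 1) (g ^ (k.toAdd 0))).mul
          (hasSection_below_of_ne (x := (true, 0)) (y := (true, 1)) (by decide)
            (φ (Multiplicative.ofAdd fun i => k.toAdd i.succ)))) w
        change ψ k _ = _ at h
        rw [hk] at h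
        simpa using h.symm
      have h2 : φ (Multiplicative.ofAdd fun i => k.toAdd i.succ) = 1 := Equiv.ext fun w => by
        have h := ((hasSection_below_of_ne (x := (true, 1)) (y := (true, 0)) (by decide)
          (g ^ (k.toAdd 0))).mul (hasSection_below (true, 0)
            (φ (Multiplicative.ofAdd fun i => k.toAdd i.succ)))) w
        change ψ k _ = _ at h
        rw [hk] at h
        simpa using h.symm
      have h0 : k.toAdd 0 = 0 := by
        have h3 : rotG ^ (((2 ^ m : ℕ) : ℤ) * k.toAdd 0) = rotG ^ (0 : ℤ) := by
          rw [zpow_mul, zpow_natCast, h1, zpow_zero]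
        have h4 := rotG_zpow_injective h3
        rcases mul_eq_zero.1 h4 with h | h
        · exact absurd (Nat.cast_eq_zero.1 h) (by positivity)
        · exact h
      have hs := (injective_iff_map_eq_one φ).1 hφ _ h2
      refine Multiplicative.toAdd.injective (funext fun i => ?_)
      refine Fin.cases h0 (fun i => ?_) i
      exact congrFun (congrArg Multiplicative.toAdd hs) i
    · refine mul_mem ?_ (hm _)
      -- The power of `rotG` is first placed below `(true, 0)` by rigidity, then moved to `(true,
      -- 1)` by `rotB`.
      have hs : HasSection rotB (true, 0) (true, 1) 1 :=
        ((hasSection_reflection_none (e := 1) (x := (false, 0)) rfl rfl).mul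
          (hasSection_reflection_none (e := 2) (x := (true, 0)) rfl rfl)).congr (by simp)
      have h := rigidGroup_conj (rotationGroup_le rotB_mem)
        (mem_rigidGroup_succ.1 (zpow_mem (rotG_pow_mem m) (k.toAdd 0)))
      rw [hs.conj_below] at h
      simpa [g] using h

/-! ### Roots on the closed upper half-plane -/

/-- The square root with values in the closed first quadrant, on the closed upper half-plane. -/
def upperSqrt (w : ℂ) : ℂ := (1 + Complex.I) / (√2 : ℝ) * (-Complex.I * w) ^ ((1 / 2 : ℝ) : ℂ)

theorem upperSqrt_sq (w : ℂ) : upperSqrt w ^ 2 = w := by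
  have h1 : (((√2 : ℝ) : ℂ)) ^ 2 = 2 := by
    rw [← Complex.ofReal_pow, Real.sq_sqrt (by norm_num)]; norm_num
  have h2 : ((-Complex.I * w) ^ ((1 / 2 : ℝ) : ℂ)) ^ 2 = -Complex.I * w := by
    rw [show ((1 / 2 : ℝ) : ℂ) = ((2 : ℕ) : ℂ)⁻¹ by push_cast; norm_num]
    exact Complex.cpow_nat_inv_pow _ two_ne_zero
  rw [upperSqrt, mul_pow, div_pow, h1, h2]
  linear_combination (-(w / 2) * Complex.I - w) * Complex.I_sq

/-- The quarter turn takes the closed upper half-plane off the cut of the principal powers, so the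
roots are continuous up to the real line, away from 0. -/
theorem rotated_mem_slitPlane {w : ℂ} (hw : 0 ≤ w.im) (h0 : w ≠ 0) :
    -Complex.I * w ∈ Complex.slitPlane := by
  rw [Complex.mem_slitPlane_iff]
  simp only [neg_mul, Complex.neg_re, Complex.mul_re, Complex.I_re, Complex.I_im, zero_mul,
    one_mul, zero_sub, neg_neg, Complex.neg_im, Complex.mul_im, zero_add, ne_eq, neg_eq_zero]
  by_contra! h
  exact h0 (Complex.ext h.2 (le_antisymm h.1 hw))

theorem continuousAt_upperSqrt {w : ℂ} (hw : 0 ≤ w.im) (h0 : w ≠ 0) :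
    ContinuousAt upperSqrt w := by
  unfold upperSqrt
  exact continuousAt_const.mul (ContinuousAt.cpow (by fun_prop) continuousAt_const
    (rotated_mem_slitPlane hw h0))

/-- The principal root of -iw lies in the sector |arg| ≤ π/4, and the prefactor is a turn by π/4. -/
theorem upperSqrt_mem {w : ℂ} (hw : 0 ≤ w.im) :
    0 ≤ (upperSqrt w).re ∧ 0 ≤ (upperSqrt w).im := by
  set y := (-Complex.I * w) ^ ((1 / 2 : ℝ) : ℂ) with hy
  have hre : 0 ≤ y.re := by
    rw [hy, Complex.cpow_ofReal_re]
    refine mul_nonneg (by positivity) (Real.cos_nonneg_of_mem_Icc ⟨?_, ?_⟩)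
    · linarith [Complex.neg_pi_lt_arg (-Complex.I * w)]
    · linarith [Complex.arg_le_pi (-Complex.I * w)]
  have hy2 : y ^ 2 = -Complex.I * w := by
    rw [hy, show ((1 / 2 : ℝ) : ℂ) = ((2 : ℕ) : ℂ)⁻¹ by push_cast; norm_num]
    exact Complex.cpow_nat_inv_pow _ two_ne_zero
  have h2 : y.re ^ 2 - y.im ^ 2 = w.im := by
    have := congrArg Complex.re hy2
    simp [sq] at this
    linarith
  have habs := abs_le.1 (abs_le_of_sq_le_sq (by linarith : y.im ^ 2 ≤ y.re ^ 2) hre)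
  have hs : 0 < √2 := by positivity
  have e : upperSqrt w = ((1 / √2 : ℝ) : ℂ) * ((1 + Complex.I) * y) := by
    rw [upperSqrt, ← hy]; push_cast; ring
  rw [e]
  constructor
  · rw [Complex.re_ofReal_mul]
    refine mul_nonneg (by positivity) ?_
    simp; linarith
  · rw [Complex.im_ofReal_mul]
    refine mul_nonneg (by positivity) ?_
    simp; linarith

theorem upperSqrt_of_pos {w : ℂ} (him : w.im = 0) (hre : 0 < w.re) :
    (upperSqrt w).im = 0 ∧ 0 < (upperSqrt w).re ∧ (upperSqrt w).re ^ 2 = w.re := by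
  obtain ⟨h1, h2⟩ := upperSqrt_mem him.ge
  have h := upperSqrt_sq w
  have hr := congrArg Complex.re h
  have hi := congrArg Complex.im h
  simp only [sq, Complex.mul_re, Complex.mul_im, him] at hr hi
  have h3 : 0 < (upperSqrt w).re := by
    rcases h1.lt_or_eq with h | h
    · exact h
    · rw [← h] at hr; nlinarith
  have h4 : (upperSqrt w).im = 0 := by nlinarith
  refine ⟨h4, h3, ?_⟩
  rw [h4] at hr; nlinarith

theorem upperSqrt_of_neg {w : ℂ} (him : w.im = 0) (hre : w.re < 0) :
    (upperSqrt w).re = 0 ∧ 0 < (upperSqrt w).im ∧ (upperSqrt w).im ^ 2 = -w.re := by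
  obtain ⟨h1, h2⟩ := upperSqrt_mem him.ge
  have h := upperSqrt_sq w
  have hr := congrArg Complex.re h
  have hi := congrArg Complex.im h
  simp only [sq, Complex.mul_re, Complex.mul_im, him] at hr hi
  have h3 : 0 < (upperSqrt w).im := by
    rcases h2.lt_or_eq with h | h
    · exact h
    · rw [← h] at hr; nlinarith
  have h4 : (upperSqrt w).re = 0 := by nlinarith
  refine ⟨h4, h3, ?_⟩
  rw [h4] at hr; nlinarith

/-- The cube root with arguments in `[0, π / 3]`, on the closed upper half-plane. -/
def upperCbrt (q : ℂ) : ℂ :=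
  ((√3 : ℝ) + Complex.I) / 2 * (-Complex.I * q) ^ ((1 / 3 : ℝ) : ℂ)

theorem sqrt_three_sq : (((√3 : ℝ) : ℂ)) ^ 2 = 3 := by
  rw [← Complex.ofReal_pow, Real.sq_sqrt (by norm_num)]; norm_num

theorem upperCbrt_pow (q : ℂ) : upperCbrt q ^ 3 = q := by
  have h2 : ((-Complex.I * q) ^ ((1 / 3 : ℝ) : ℂ)) ^ 3 = -Complex.I * q := by
    rw [show ((1 / 3 : ℝ) : ℂ) = ((3 : ℕ) : ℂ)⁻¹ by push_cast; norm_num]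
    exact Complex.cpow_nat_inv_pow _ three_ne_zero
  have h3 : (((√3 : ℝ) + Complex.I) / 2) ^ 3 = Complex.I := by
    linear_combination (((√3 : ℝ) : ℂ) / 8 + 3 / 8 * Complex.I) * sqrt_three_sq +
      (3 / 8 * ((√3 : ℝ) : ℂ) + Complex.I / 8) * Complex.I_sq
  rw [upperCbrt, mul_pow, h2, h3]
  linear_combination -q * Complex.I_sq

theorem continuousAt_upperCbrt {q : ℂ} (hq : 0 ≤ q.im) (h0 : q ≠ 0) :
    ContinuousAt upperCbrt q := by
  unfold upperCbrt
  exact continuousAt_const.mul (ContinuousAt.cpow (by fun_prop) continuousAt_const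
    (rotated_mem_slitPlane hq h0))

/-- The principal cube root of -iq has |arg| ≤ π/6, and the prefactor is a turn by π/6. The second
inequality says arg ≤ π/3. -/
theorem upperCbrt_mem {q : ℂ} (hq : 0 ≤ q.im) :
    0 ≤ (upperCbrt q).im ∧ (upperCbrt q).im ≤ √3 * (upperCbrt q).re := by
  set y := (-Complex.I * q) ^ ((1 / 3 : ℝ) : ℂ) with hy
  have hs : (√3 : ℝ) ^ 2 = 3 := Real.sq_sqrt (by norm_num)
  have hs0 : (0 : ℝ) < √3 := by positivity
  have harg : |Complex.arg (-Complex.I * q)| ≤ Real.pi / 2 := by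
    rw [Complex.abs_arg_le_pi_div_two_iff]; simpa using hq
  obtain ⟨ha, hb⟩ := abs_le.1 harg
  set θ := Complex.arg (-Complex.I * q) * (1 / 3) with hθ
  have hsin1 : Real.sin θ ≤ 1 / 2 := by
    rw [← Real.sin_pi_div_six]
    exact Real.sin_le_sin_of_le_of_le_pi_div_two (by linarith [Real.pi_pos])
      (by linarith [Real.pi_pos]) (by linarith)
  have hsin2 : -(1 / 2) ≤ Real.sin θ := by
    rw [← Real.sin_pi_div_six, ← Real.sin_neg]
    exact Real.sin_le_sin_of_le_of_le_pi_div_two (by linarith [Real.pi_pos])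
      (by linarith [Real.pi_pos]) (by linarith)
  have hcos0 : 0 ≤ Real.cos θ :=
    Real.cos_nonneg_of_mem_Icc ⟨by linarith [Real.pi_pos], by linarith [Real.pi_pos]⟩
  have hcos : √3 / 2 ≤ Real.cos θ := by
    refine abs_le_of_sq_le_sq' ?_ hcos0 |>.2
    nlinarith [Real.sin_sq_add_cos_sq θ]
  have hyr : y.re = ‖-Complex.I * q‖ ^ (1 / 3 : ℝ) * Real.cos θ := by
    rw [hy, Complex.cpow_ofReal_re]
  have hyi : y.im = ‖-Complex.I * q‖ ^ (1 / 3 : ℝ) * Real.sin θ := by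
    rw [hy, Complex.cpow_ofReal_im]
  have hn : 0 ≤ ‖-Complex.I * q‖ ^ (1 / 3 : ℝ) := by positivity
  set ρ := ‖-Complex.I * q‖ ^ (1 / 3 : ℝ)
  have h1 : √3 * y.im ≤ y.re := by
    rw [hyr, hyi]
    nlinarith [mul_le_mul_of_nonneg_left (show √3 * Real.sin θ ≤ Real.cos θ by nlinarith) hn]
  have h2 : -(√3 * y.im) ≤ y.re := by
    rw [hyr, hyi]
    nlinarith [mul_le_mul_of_nonneg_left (show -(√3 * Real.sin θ) ≤ Real.cos θ by nlinarith) hn]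
  have er : (upperCbrt q).re = (√3 * y.re - y.im) / 2 := by
    rw [upperCbrt, ← hy, div_mul_eq_mul_div]; simp
  have ei : (upperCbrt q).im = (y.re + √3 * y.im) / 2 := by
    rw [upperCbrt, ← hy, div_mul_eq_mul_div]; simp; ring
  rw [er, ei]
  constructor
  · linarith
  · nlinarith

/-- The primitive cube root of unity in the upper half-plane. -/
def omega : ℂ := (-1 + (√3 : ℝ) * Complex.I) / 2

theorem omega_sq : omega ^ 2 = -omega - 1 := by
  rw [omega]
  linear_combination (Complex.I ^ 2 / 4) * sqrt_three_sq + 3 / 4 * Complex.I_sq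

theorem omega_pow_three : omega ^ 3 = 1 := by
  linear_combination (omega - 1) * omega_sq

theorem omega_ne_one : omega ≠ 1 := by
  intro h
  have := omega_sq
  rw [h] at this
  norm_num at this

theorem omega_re : omega.re = -1 / 2 := by simp [omega]
theorem omega_im : omega.im = √3 / 2 := by simp [omega]

theorem star_omega : (starRingEnd ℂ) omega = omega ^ 2 := by
  rw [omega_sq]
  apply Complex.ext
  · simp [omega_re]; norm_num
  · simp

/-! ### The parameter of the inverse branches -/

/-- The square of the inverse branch of `f₁` with parameter `r`. -/
def squareOf (r : ℂ) : ℂ := 3 / 4 * (r - 1) ^ 2 / (r ^ 2 - r + 1)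

/-- Substituting z² = `squareOf r` turns f₁ + 1 into -8r³/(r³ - 1)², which depends only on q = r³.
Solving the cubic for z² thus reduces to extracting cube roots of q. -/
theorem squareOf_equation {r t : ℂ} (h1 : r ^ 3 ≠ 1) (h2 : r ^ 3 ≠ -1)
    (ht : (t + 1) * (r ^ 3 - 1) ^ 2 = -8 * r ^ 3) :
    squareOf r * (squareOf r - 9 / 8) ^ 2 ≠ 0 ∧
      2 * (squareOf r - 3 / 4) ^ 3 = (t + 1) * (squareOf r * (squareOf r - 9 / 8) ^ 2) := by
  have hN : r ^ 2 - r + 1 ≠ 0 := fun h => h2 (by linear_combination (r + 1) * h)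
  have hq : r ^ 3 - 1 ≠ 0 := sub_ne_zero.2 h1
  obtain ⟨N, hNe⟩ : ∃ N, r ^ 2 - r + 1 = N := ⟨_, rfl⟩
  have e0 : squareOf r = 3 / 4 * (r - 1) ^ 2 / N := by rw [squareOf, hNe]
  rw [hNe] at hN
  have e3 : squareOf r - 3 / 4 = -(3 / 4) * r / N := by
    rw [eq_div_iff hN, sub_mul, e0, div_mul_cancel₀ _ hN, ← hNe]; ring
  have e9 : squareOf r - 9 / 8 = -(3 / 8) * (r ^ 2 + r + 1) / N := by
    rw [eq_div_iff hN, sub_mul, e0, div_mul_cancel₀ _ hN, ← hNe]; ring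
  have e1 : squareOf r * (squareOf r - 9 / 8) ^ 2 = 27 / 256 * (r ^ 3 - 1) ^ 2 / N ^ 3 := by
    rw [e9, e0]; ring
  rw [e1, e3]
  constructor
  · exact div_ne_zero (mul_ne_zero (by norm_num) (pow_ne_zero _ hq)) (pow_ne_zero _ hN)
  · linear_combination -(27 / 256) / N ^ 3 * ht

theorem squareOf_ne {r r' : ℂ} (h : r ^ 3 ≠ -1) (h' : r' ^ 3 ≠ -1) (hne : r ≠ r')
    (hmul : r * r' ≠ 1) : squareOf r ≠ squareOf r' := by
  have hN : r ^ 2 - r + 1 ≠ 0 := fun e => h (by linear_combination (r + 1) * e)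
  have hN' : r' ^ 2 - r' + 1 ≠ 0 := fun e => h' (by linear_combination (r' + 1) * e)
  intro e
  rw [squareOf, squareOf, div_eq_div_iff hN hN'] at e
  have : (r - r') * (r * r' - 1) = 0 := by linear_combination 4 / 3 * e
  rcases mul_eq_zero.1 this with h | h
  · exact hne (sub_eq_zero.1 h)
  · exact hmul (sub_eq_zero.1 h)

/-- For r ≠ 0, `squareOf r` equals 3/4 · (1 - 1/(s - 1)) with s = r + 1/r. The formula decides the
half-plane of each square. -/
theorem squareOf_im (r : ℂ) : (squareOf r).im =
    3 / 4 * (r.im * (Complex.normSq r - 1)) / Complex.normSq (r ^ 2 - r + 1) := by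
  rw [squareOf, Complex.div_im, ← sub_div]
  congr 1
  simp [Complex.normSq_apply, sq]
  ring

theorem squareOf_star (r : ℂ) : squareOf ((starRingEnd ℂ) r) = (starRingEnd ℂ) (squareOf r) := by
  simp [squareOf, map_ofNat]

/-- The closed upper half-plane without the postcritical points. -/
def closedUpper : Set ℂ := {t | 0 ≤ t.im ∧ t ≠ 1 ∧ t ≠ -1}

/-- The uniformizing parameter `q` of the closed upper half-plane. -/
def joukowskiParam (t : ℂ) : ℂ :=
  (upperSqrt ((t - 1) / 2) + Complex.I) / (upperSqrt ((t - 1) / 2) - Complex.I)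

theorem upperSqrt_param {t : ℂ} (ht : t ∈ closedUpper) :
    (0 ≤ ((t - 1) / 2).im) ∧ (t - 1) / 2 ≠ 0 ∧ upperSqrt ((t - 1) / 2) ≠ 0 ∧
      upperSqrt ((t - 1) / 2) - Complex.I ≠ 0 := by
  obtain ⟨h0, h1, h2⟩ := ht
  have e : (t - 1) / 2 ≠ 0 := div_ne_zero (sub_ne_zero.2 h1) two_ne_zero
  have h := upperSqrt_sq ((t - 1) / 2)
  refine ⟨?_, e, fun h3 => ?_, fun h3 => ?_⟩
  · simpa using div_nonneg h0 zero_le_two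
  · rw [h3] at h; exact e (by rw [← h]; norm_num)
  · rw [sub_eq_zero.1 h3, Complex.I_sq] at h
    exact h2 (by linear_combination -2 * h)

/-- With σ² = (t - 1)/2 one has t + 1 = 2(σ + i)(σ - i), which gives the equation. The bounds hold
because σ lies in the closed first quadrant. -/
theorem joukowskiParam_spec {t : ℂ} (ht : t ∈ closedUpper) :
    0 ≤ (joukowskiParam t).im ∧ 1 ≤ Complex.normSq (joukowskiParam t) ∧ joukowskiParam t ≠ 1 ∧
      joukowskiParam t ≠ -1 ∧
      (t + 1) * (joukowskiParam t - 1) ^ 2 = -8 * joukowskiParam t := by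
  obtain ⟨h0, h1, h2, h3⟩ := upperSqrt_param ht
  obtain ⟨hr, hi⟩ := upperSqrt_mem h0
  have hsq := upperSqrt_sq ((t - 1) / 2)
  rw [joukowskiParam]
  set σ := upperSqrt ((t - 1) / 2)
  have hn : 0 < Complex.normSq (σ - Complex.I) := Complex.normSq_pos.2 h3
  refine ⟨?_, ?_, ?_, ?_, ?_⟩
  · rw [Complex.div_im, ← sub_div]
    refine div_nonneg ?_ hn.le
    simp; nlinarith
  · rw [map_div₀, one_le_div hn]
    simp [Complex.normSq_apply]; nlinarith
  · rw [Ne, div_eq_one_iff_eq h3]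
    intro h
    have := congrArg Complex.im h
    simp at this
    linarith
  · rw [Ne, div_eq_iff h3]
    intro h
    exact h2 (by linear_combination h / 2)
  · field_simp
    linear_combination (8 : ℂ) * hsq + 4 * (t - 1) * Complex.I_sq

/-- The cube root of the uniformizing parameter. -/
def rootParam (t : ℂ) : ℂ := upperCbrt (joukowskiParam t)

theorem continuousAt_rootParam {t : ℂ} (ht : t ∈ closedUpper) : ContinuousAt rootParam t := by
  obtain ⟨h0, h1, h2, h3⟩ := upperSqrt_param ht
  obtain ⟨g0, g1, -, -, -⟩ := joukowskiParam_spec ht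
  have hc : ContinuousAt (fun t : ℂ => upperSqrt ((t - 1) / 2)) t :=
    ContinuousAt.comp (g := upperSqrt) (continuousAt_upperSqrt h0 h1) (by fun_prop)
  refine ContinuousAt.comp (g := upperCbrt) (continuousAt_upperCbrt g0 ?_)
    ((hc.add continuousAt_const).div (hc.sub continuousAt_const) h3)
  intro h
  rw [h] at g1
  norm_num at g1

theorem rootParam_spec {t : ℂ} (ht : t ∈ closedUpper) :
    0 ≤ (rootParam t).im ∧ (rootParam t).im ≤ √3 * (rootParam t).re ∧
      1 ≤ Complex.normSq (rootParam t) ∧ rootParam t ^ 3 ≠ 1 ∧ rootParam t ^ 3 ≠ -1 ∧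
      (t + 1) * (rootParam t ^ 3 - 1) ^ 2 = -8 * rootParam t ^ 3 := by
  obtain ⟨g0, g1, g2, g3, g4⟩ := joukowskiParam_spec ht
  have h := upperCbrt_mem g0
  have hp : rootParam t ^ 3 = joukowskiParam t := upperCbrt_pow _
  refine ⟨h.1, h.2, ?_, by rwa [hp], by rwa [hp], by rwa [hp]⟩
  rw [← hp, map_pow] at g1
  by_contra! hlt
  exact absurd g1 (not_le.2 (pow_lt_one₀ (Complex.normSq_nonneg _) hlt three_ne_zero))

/-- The three parameters of the inverse branches. -/
def branchParam (t : ℂ) : Fin 3 → ℂ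
  | 0 => rootParam t
  | 1 => omega ^ 2 * rootParam t
  | 2 => omega * rootParam t

theorem branchParam_pow (t : ℂ) (k : Fin 3) : branchParam t k ^ 3 = rootParam t ^ 3 := by
  fin_cases k
  · rfl
  · simp only [branchParam]
    linear_combination (rootParam t ^ 3 * (omega ^ 3 + 1)) * omega_pow_three
  · simp only [branchParam]; linear_combination rootParam t ^ 3 * omega_pow_three

theorem normSq_omega : Complex.normSq omega = 1 := by
  rw [Complex.normSq_apply, omega_re, omega_im]
  nlinarith [Real.sq_sqrt (show (0 : ℝ) ≤ 3 by norm_num)]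

theorem normSq_branchParam (t : ℂ) (k : Fin 3) :
    Complex.normSq (branchParam t k) = Complex.normSq (rootParam t) := by
  fin_cases k <;> simp [branchParam, normSq_omega]

theorem omega_sq_re : (omega ^ 2).re = -1 / 2 := by rw [omega_sq]; simp [omega_re]; norm_num
theorem omega_sq_im : (omega ^ 2).im = -√3 / 2 := by rw [omega_sq]; simp [omega_im]; ring

/-- The arguments of the three parameters lie in [0, π/3], [4π/3, 5π/3] and [2π/3, π]. -/
theorem branchParam_im {t : ℂ} (ht : t ∈ closedUpper) :
    0 ≤ (branchParam t 0).im ∧ (branchParam t 1).im ≤ 0 ∧ 0 ≤ (branchParam t 2).im := by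
  obtain ⟨h1, h2, -⟩ := rootParam_spec ht
  have hs0 : (0 : ℝ) < √3 := by positivity
  refine ⟨h1, ?_, ?_⟩
  · simp only [branchParam, Complex.mul_im, omega_sq_re, omega_sq_im]; nlinarith
  · simp only [branchParam, Complex.mul_im, omega_re, omega_im]; nlinarith

/-- The squares of the inverse branches. -/
def branchSquare (t : ℂ) (k : Fin 3) : ℂ := squareOf (branchParam t k)

theorem branchSquare_im {t : ℂ} (ht : t ∈ closedUpper) :
    0 ≤ (branchSquare t 0).im ∧ (branchSquare t 1).im ≤ 0 ∧ 0 ≤ (branchSquare t 2).im := by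
  obtain ⟨h1, h2, h3⟩ := branchParam_im ht
  have hn := (rootParam_spec ht).2.2.1
  simp only [branchSquare, squareOf_im, normSq_branchParam]
  refine ⟨?_, ?_, ?_⟩
  · exact div_nonneg (mul_nonneg (by norm_num) (mul_nonneg h1 (by linarith)))
      (Complex.normSq_nonneg _)
  · exact div_nonpos_of_nonpos_of_nonneg (mul_nonpos_of_nonneg_of_nonpos (by norm_num)
      (mul_nonpos_of_nonpos_of_nonneg h2 (by linarith))) (Complex.normSq_nonneg _)
  · exact div_nonneg (mul_nonneg (by norm_num) (mul_nonneg h3 (by linarith)))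
      (Complex.normSq_nonneg _)

theorem branchSquare_equation {t : ℂ} (ht : t ∈ closedUpper) (k : Fin 3) :
    branchSquare t k * (branchSquare t k - 9 / 8) ^ 2 ≠ 0 ∧
      2 * (branchSquare t k - 3 / 4) ^ 3 =
        (t + 1) * (branchSquare t k * (branchSquare t k - 9 / 8) ^ 2) := by
  obtain ⟨-, -, -, h1, h2, h3⟩ := rootParam_spec ht
  refine squareOf_equation ?_ ?_ ?_ <;> rw [branchParam_pow] <;> assumption

theorem rootParam_ne_zero {t : ℂ} (ht : t ∈ closedUpper) : rootParam t ≠ 0 := by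
  intro h
  have := (rootParam_spec ht).2.2.1
  rw [h] at this
  norm_num at this

/-- `squareOf` identifies r only with 1/r. Two cube roots of q with product 1 would force q² = 1,
which is excluded. -/
theorem branchSquare_injective {t : ℂ} (ht : t ∈ closedUpper) :
    Function.Injective (branchSquare t) := by
  obtain ⟨-, -, -, h1, h2, -⟩ := rootParam_spec ht
  have h0 := rootParam_ne_zero ht
  have hw : omega ≠ 0 := fun h => by have := omega_pow_three; rw [h] at this; norm_num at this
  have hinj : Function.Injective (branchParam t) := by
    have a1 : omega ^ 2 ≠ 1 := fun h => omega_ne_one (by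
      linear_combination omega_pow_three - omega * h)
    have a2 : omega ^ 2 ≠ omega := fun h => omega_ne_one (by
      have : omega * (omega - 1) = 0 := by linear_combination h
      exact sub_eq_zero.1 ((mul_eq_zero.1 this).resolve_left hw))
    have b1 : omega ^ 2 * rootParam t ≠ rootParam t := fun h =>
      a1 (mul_right_cancel₀ h0 (by rw [h, one_mul]))
    have b2 : omega * rootParam t ≠ rootParam t := fun h =>
      omega_ne_one (mul_right_cancel₀ h0 (by rw [h, one_mul]))
    have b3 : omega ^ 2 * rootParam t ≠ omega * rootParam t := fun h =>
      a2 (mul_right_cancel₀ h0 h)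
    intro k l hkl
    fin_cases k <;> fin_cases l <;> first | rfl | (simp only [branchParam] at hkl)
    · exact absurd hkl.symm b1
    · exact absurd hkl.symm b2
    · exact absurd hkl b1
    · exact absurd hkl b3
    · exact absurd hkl b2
    · exact absurd hkl.symm b3
  intro k l hkl
  by_contra hne
  refine squareOf_ne (r := branchParam t k) (r' := branchParam t l) ?_ ?_ (hinj.ne hne) ?_ hkl
  · rwa [branchParam_pow]
  · rwa [branchParam_pow]
  · intro h
    have h3 : rootParam t ^ 3 * rootParam t ^ 3 = 1 := by
      nth_rewrite 1 [← branchParam_pow t k]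
      rw [← branchParam_pow t l, ← mul_pow, h, one_pow]
    rcases mul_self_eq_one_iff.1 h3 with h | h
    · exact h1 h
    · exact h2 h

/-- The equation is a cubic in w with leading coefficient 1 - t ≠ 0, up to sign conventions;
successive divided differences show that a fourth root is impossible. -/
theorem exists_branchSquare {t w : ℂ} (ht : t ∈ closedUpper)
    (hw : 2 * (w - 3 / 4) ^ 3 = (t + 1) * (w * (w - 9 / 8) ^ 2)) :
    ∃ k, w = branchSquare t k := by
  by_contra! hne
  have hi := branchSquare_injective ht
  have h0 := (branchSquare_equation ht 0).2
  have h1 := (branchSquare_equation ht 1).2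
  have h2 := (branchSquare_equation ht 2).2
  have d01 : branchSquare t 1 - branchSquare t 0 ≠ 0 := sub_ne_zero.2 (hi.ne (by decide))
  have d02 : branchSquare t 2 - branchSquare t 0 ≠ 0 := sub_ne_zero.2 (hi.ne (by decide))
  have d12 : branchSquare t 2 - branchSquare t 1 ≠ 0 := sub_ne_zero.2 (hi.ne (by decide))
  have n0 := sub_ne_zero.2 (hne 0)
  have n1 := sub_ne_zero.2 (hne 1)
  have n2 := sub_ne_zero.2 (hne 2)
  set a := branchSquare t 0
  set b := branchSquare t 1
  set c := branchSquare t 2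
  have q (x y : ℂ) (hx : 2 * (x - 3 / 4) ^ 3 = (t + 1) * (x * (x - 9 / 8) ^ 2))
      (hy : 2 * (y - 3 / 4) ^ 3 = (t + 1) * (y * (y - 9 / 8) ^ 2)) (hxy : x - y ≠ 0) :
      (1 - t) * (x ^ 2 + x * y + y ^ 2) + (-9 / 2 + (t + 1) * (9 / 4)) * (x + y) +
        (27 / 8 - (t + 1) * (81 / 64)) = 0 := by
    apply mul_left_cancel₀ hxy
    linear_combination hx - hy
  have r (x : ℂ) (hx : 2 * (x - 3 / 4) ^ 3 = (t + 1) * (x * (x - 9 / 8) ^ 2)) (hxa : x - a ≠ 0)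
      (hxb : x - b ≠ 0) : (1 - t) * (x + a + b) + (-9 / 2 + (t + 1) * (9 / 4)) = 0 := by
    apply mul_left_cancel₀ hxb
    linear_combination q x a hx h0 hxa - q b a h1 h0 d01
  have : (1 - t) * (w - c) = 0 := by
    linear_combination r w hw n0 n1 - r c h2 d02 d12
  rcases mul_eq_zero.1 this with h | h
  · exact ht.2.1 (sub_eq_zero.1 h).symm
  · exact n2 h

/-! ### The inverse branches on the closed upper half-plane -/

/-- The inverse branches with positive sign. -/
def upperBranch : Fin 3 → ℂ → ℂ
  | 0, t => upperSqrt (branchSquare t 0)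
  | 1, t => -(starRingEnd ℂ) (upperSqrt ((starRingEnd ℂ) (branchSquare t 1)))
  | 2, t => upperSqrt (branchSquare t 2)

theorem upperBranch_sq (k : Fin 3) (t : ℂ) : upperBranch k t ^ 2 = branchSquare t k := by
  fin_cases k
  · exact upperSqrt_sq _
  · simp only [upperBranch, neg_sq, ← map_pow]
    rw [upperSqrt_sq, Complex.conj_conj]
    rfl
  · exact upperSqrt_sq _

theorem upperBranch_im {t : ℂ} (ht : t ∈ closedUpper) (k : Fin 3) :
    0 ≤ (upperBranch k t).im := by
  obtain ⟨h1, h2, h3⟩ := branchSquare_im ht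
  fin_cases k
  · exact (upperSqrt_mem h1).2
  · simp only [upperBranch, Complex.neg_im, Complex.conj_im, neg_neg]
    exact (upperSqrt_mem (by simpa using h2)).2
  · exact (upperSqrt_mem h3).2

theorem continuousAt_branchSquare {t : ℂ} (ht : t ∈ closedUpper) (k : Fin 3) :
    ContinuousAt (fun t => branchSquare t k) t := by
  have hr := continuousAt_rootParam ht
  have hb : ContinuousAt (fun t => branchParam t k) t := by
    fin_cases k
    · exact hr
    · exact continuousAt_const.mul hr
    · exact continuousAt_const.mul hr
  have hN : branchParam t k ^ 2 - branchParam t k + 1 ≠ 0 := by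
    intro h
    refine (rootParam_spec ht).2.2.2.2.1 ?_
    rw [← branchParam_pow t k]
    linear_combination (branchParam t k + 1) * h
  unfold branchSquare squareOf
  exact (continuousAt_const.mul ((hb.sub continuousAt_const).pow 2)).div
    (((hb.pow 2).sub hb).add continuousAt_const) hN

theorem continuousAt_upperBranch {t : ℂ} (ht : t ∈ closedUpper) (k : Fin 3) :
    ContinuousAt (upperBranch k) t := by
  obtain ⟨h1, h2, h3⟩ := branchSquare_im ht
  have hc := continuousAt_branchSquare ht k
  have h0 : branchSquare t k ≠ 0 := (mul_ne_zero_iff.1 (branchSquare_equation ht k).1).1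
  fin_cases k
  · exact ContinuousAt.comp (g := upperSqrt) (continuousAt_upperSqrt h1 h0) hc
  · refine (Complex.continuous_conj.continuousAt.comp (ContinuousAt.comp (g := upperSqrt)
      (continuousAt_upperSqrt ?_ ?_) (Complex.continuous_conj.continuousAt.comp hc))).neg
    · simpa using h2
    · simpa using h0
  · exact ContinuousAt.comp (g := upperSqrt) (continuousAt_upperSqrt h3 h0) hc

/-- Both 1 and -1 map to 1, so no branch over t ≠ 1 takes these values. This lets the branches be
iterated. -/
theorem upperBranch_mem {t : ℂ} (ht : t ∈ closedUpper) (k : Fin 3) :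
    upperBranch k t ∈ closedUpper := by
  have hsq : upperBranch k t ^ 2 ≠ 1 := by
    rw [upperBranch_sq]
    intro h
    have h1 := (branchSquare_equation ht k).2
    rw [h] at h1
    exact ht.2.1 (by linear_combination -64 * h1)
  exact ⟨upperBranch_im ht k, fun h => hsq (by rw [h]; norm_num),
    fun h => hsq (by rw [h]; norm_num)⟩

/-! ### Boundary values of the inverse branches -/

/-- The three real intervals between the postcritical points. -/
def edgeSet : Fin 3 → Set ℂ
  | 0 => {x | x.im = 0 ∧ x.re < -1}
  | 1 => {x | x.im = 0 ∧ -1 < x.re ∧ x.re < 1}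
  | 2 => {x | x.im = 0 ∧ 1 < x.re}

theorem edgeSet_im {e : Fin 3} {x : ℂ} (hx : x ∈ edgeSet e) : x.im = 0 := by
  fin_cases e <;> exact hx.1

theorem edgeSet_neg {e : Fin 3} {x : ℂ} (hx : x ∈ edgeSet e) :
    -x ∈ edgeSet (2 - e) := by
  fin_cases e
  · exact ⟨by simp [hx.1], by simpa using lt_neg_of_lt_neg hx.2⟩
  · exact ⟨by simp [hx.1], by simpa using hx.2.2, by simpa using neg_lt.1 (by simpa using hx.2.1)⟩
  · exact ⟨by simp [hx.1], by simpa using hx.2⟩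

theorem edgeSet_subset {e : Fin 3} {x : ℂ} (hx : x ∈ edgeSet e) : x ∈ closedUpper := by
  refine ⟨(edgeSet_im hx).ge, ?_, ?_⟩ <;> rintro rfl <;> fin_cases e <;>
    simp [edgeSet] at hx <;> linarith

theorem eq_ofReal_of_im_eq_zero {z : ℂ} (h : z.im = 0) : z = (z.re : ℂ) :=
  Complex.ext rfl (by simpa using h)

/-- Here the square root is iτ, so q is real; τ = 1 corresponds to the point -1 between the two
edges. -/
theorem joukowskiParam_of_neg {x : ℂ} (him : x.im = 0) (hre : x.re < 1) :
    ∃ τ : ℝ, 0 < τ ∧ τ ^ 2 = (1 - x.re) / 2 ∧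
      joukowskiParam x = (((τ + 1) / (τ - 1) : ℝ) : ℂ) := by
  have h1 : ((x - 1) / 2).im = 0 := by simp [him]
  have h2 : ((x - 1) / 2).re = (x.re - 1) / 2 := by simp
  obtain ⟨hr, hi, hs⟩ := upperSqrt_of_neg h1 (by rw [h2]; linarith)
  refine ⟨_, hi, by rw [hs, h2]; ring, ?_⟩
  rw [joukowskiParam]
  set σ := upperSqrt ((x - 1) / 2)
  have e : σ = σ.im * Complex.I := Complex.ext (by simp [hr]) (by simp)
  have e1 : σ + Complex.I = Complex.I * ((σ.im : ℂ) + 1) := by nth_rewrite 1 [e]; ring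
  have e2 : σ - Complex.I = Complex.I * ((σ.im : ℂ) - 1) := by nth_rewrite 1 [e]; ring
  rw [e1, e2, mul_div_mul_left _ _ Complex.I_ne_zero]
  push_cast
  rfl

theorem rootParam_cube_parts {t : ℂ} (q : ℝ) (hq : joukowskiParam t = q) :
    (rootParam t).im * (3 * (rootParam t).re ^ 2 - (rootParam t).im ^ 2) = 0 ∧
      (rootParam t).re * ((rootParam t).re ^ 2 - 3 * (rootParam t).im ^ 2) = q := by
  have h : rootParam t ^ 3 = q := by rw [← hq]; exact upperCbrt_pow _
  have hr := congrArg Complex.re h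
  have hi := congrArg Complex.im h
  simp only [pow_succ, pow_zero, one_mul, Complex.mul_re, Complex.mul_im, Complex.ofReal_re,
    Complex.ofReal_im] at hr hi
  constructor
  · linear_combination hi
  · linear_combination hr

theorem rootParam_of_left {x : ℂ} (hx : x ∈ edgeSet 0) :
    (rootParam x).im = 0 ∧ 1 < (rootParam x).re := by
  obtain ⟨him, hre⟩ := hx
  obtain ⟨τ, h0, h1, hq⟩ := joukowskiParam_of_neg him (by linarith)
  have ht : 1 < τ := by nlinarith
  have hq1 : 1 < (τ + 1) / (τ - 1) := by rw [one_lt_div (by linarith)]; linarith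
  obtain ⟨e1, e2⟩ := rootParam_cube_parts _ hq
  obtain ⟨hy, hyx, -⟩ := rootParam_spec (edgeSet_subset (e := 0) ⟨him, hre⟩)
  have hs : (√3 : ℝ) ^ 2 = 3 := Real.sq_sqrt (by norm_num)
  have hs0 : (0 : ℝ) < √3 := by positivity
  set a := (rootParam x).re
  set b := (rootParam x).im
  have ha : 0 ≤ a := by
    by_contra! h
    nlinarith
  have hb : b = 0 := by
    rcases mul_eq_zero.1 e1 with h | h
    · exact h
    · have : 0 ≤ 8 * a ^ 3 := by positivity
      nlinarith
  refine ⟨hb, ?_⟩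
  by_contra! h
  have : a ^ 3 ≤ 1 := pow_le_one₀ ha h
  rw [hb] at e2
  nlinarith

/-- Now q < -1, so its cube root in the sector lies on the ray of argument π/3. -/
theorem rootParam_of_mid {x : ℂ} (hx : x ∈ edgeSet 1) :
    (rootParam x).im = √3 * (rootParam x).re ∧ 1 / 2 < (rootParam x).re := by
  obtain ⟨him, hre, hre'⟩ := hx
  obtain ⟨τ, h0, h1, hq⟩ := joukowskiParam_of_neg him hre'
  have ht : τ < 1 := by nlinarith
  have hq1 : (τ + 1) / (τ - 1) < -1 := by
    rw [div_lt_iff_of_neg (by linarith)]; linarith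
  obtain ⟨e1, e2⟩ := rootParam_cube_parts _ hq
  obtain ⟨hy, hyx, -⟩ := rootParam_spec (edgeSet_subset (e := 1) ⟨him, hre, hre'⟩)
  have hs : (√3 : ℝ) ^ 2 = 3 := Real.sq_sqrt (by norm_num)
  have hs0 : (0 : ℝ) < √3 := by positivity
  set a := (rootParam x).re
  set b := (rootParam x).im
  have ha : 0 ≤ a := by
    by_contra! h
    nlinarith
  have hb : b ^ 2 = 3 * a ^ 2 := by
    rcases mul_eq_zero.1 e1 with h | h
    · rw [h] at e2
      have : 0 ≤ a ^ 3 := by positivity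
      nlinarith
    · linarith
  refine ⟨?_, ?_⟩
  · rw [← abs_of_nonneg hy, ← abs_of_nonneg (mul_nonneg hs0.le ha), ← sq_eq_sq_iff_abs_eq_abs]
    nlinarith
  · by_contra! h
    have : a ^ 3 ≤ (1 / 2) ^ 3 := pow_le_pow_left₀ ha h 3
    rw [hb] at e2
    nlinarith

/-- The square root is real, so |q| = 1. The ends of the arc would give q = 1 or q = -1. -/
theorem rootParam_of_right {x : ℂ} (hx : x ∈ edgeSet 2) :
    Complex.normSq (rootParam x) = 1 ∧ 0 < (rootParam x).im ∧
      (rootParam x).im < √3 * (rootParam x).re := by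
  have hxu := edgeSet_subset hx
  obtain ⟨him, hre⟩ := hx
  have h1 : ((x - 1) / 2).im = 0 := by simp [him]
  have h2 : ((x - 1) / 2).re = (x.re - 1) / 2 := by simp
  obtain ⟨hi, hr, -⟩ := upperSqrt_of_pos h1 (by rw [h2]; linarith)
  have hp : rootParam x ^ 3 = joukowskiParam x := upperCbrt_pow _
  have hn : Complex.normSq (rootParam x) = 1 := by
    have h3 : Complex.normSq (rootParam x) ^ 3 = 1 := by
      obtain ⟨-, -, -, h⟩ := upperSqrt_param hxu
      rw [← map_pow, hp, joukowskiParam, map_div₀, div_eq_one_iff_eq (Complex.normSq_pos.2 h).ne']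
      simp [Complex.normSq_apply, hi]
    exact (pow_eq_one_iff_of_nonneg (Complex.normSq_nonneg _) three_ne_zero).1 h3
  obtain ⟨hy, hyx, -, q1, q2, -⟩ := rootParam_spec hxu
  have hs : (√3 : ℝ) ^ 2 = 3 := Real.sq_sqrt (by norm_num)
  have hs0 : (0 : ℝ) < √3 := by positivity
  have ha : 0 ≤ (rootParam x).re := by
    by_contra! h
    nlinarith
  have hn' := hn
  rw [Complex.normSq_apply] at hn'
  refine ⟨hn, hy.lt_of_ne' fun h => q1 ?_, hyx.lt_of_ne fun h => q2 ?_⟩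
  · rw [h] at hn'
    have : (rootParam x).re = 1 := by nlinarith
    rw [eq_ofReal_of_im_eq_zero h, this]
    norm_num
  · rw [h] at hn'
    have e : (rootParam x).re = 1 / 2 := by nlinarith
    have : rootParam x = 1 / 2 * (1 + (√3 : ℝ) * Complex.I) := by
      apply Complex.ext
      · simp [e]
      · rw [h, e]; simp; ring
    rw [this]
    linear_combination (3 / 8 * Complex.I ^ 2 + ((√3 : ℝ) : ℂ) / 8 * Complex.I ^ 3) * sqrt_three_sq
      + (9 / 8 + 3 / 8 * ((√3 : ℝ) : ℂ) * Complex.I) * Complex.I_sq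

theorem squareOf_of_real {r : ℂ} (h : r.im = 0) : (squareOf r).im = 0 ∧
    (squareOf r).re = 3 / 4 * (r.re - 1) ^ 2 / (r.re ^ 2 - r.re + 1) := by
  have e : squareOf r = ((3 / 4 * (r.re - 1) ^ 2 / (r.re ^ 2 - r.re + 1) : ℝ) : ℂ) := by
    nth_rewrite 1 [eq_ofReal_of_im_eq_zero h]
    rw [squareOf]; push_cast; ring
  rw [e]
  exact ⟨Complex.ofReal_im _, Complex.ofReal_re _⟩

/-- On the unit circle r + 1/r is twice the real part of r. -/
theorem squareOf_of_circle {r : ℂ} (h : Complex.normSq r = 1) (hr : r.re ≠ 1 / 2) :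
    (squareOf r).im = 0 ∧ (squareOf r).re = 3 / 2 * (r.re - 1) / (2 * r.re - 1) := by
  have hc : r * (starRingEnd ℂ) r = 1 := by rw [Complex.mul_conj, h]; norm_num
  have hs : r + (starRingEnd ℂ) r = 2 * (r.re : ℂ) := by rw [Complex.add_conj]; push_cast; ring
  have h0 : r ≠ 0 := by rintro rfl; norm_num at h
  have hd : 2 * (r.re : ℂ) - 1 ≠ 0 := by
    intro h
    have : 2 * r.re - 1 = 0 := by exact_mod_cast h
    exact hr (by linarith)
  have e1 : (r - 1) ^ 2 = r * (2 * (r.re : ℂ) - 2) := by linear_combination r * hs - hc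
  have e2 : r ^ 2 - r + 1 = r * (2 * (r.re : ℂ) - 1) := by linear_combination r * hs - hc
  have e : squareOf r = ((3 / 2 * (r.re - 1) / (2 * r.re - 1) : ℝ) : ℂ) := by
    rw [squareOf, mul_div_assoc, e1, e2, mul_div_mul_left _ _ h0]
    push_cast
    ring
  rw [e]
  exact ⟨Complex.ofReal_im _, Complex.ofReal_re _⟩

theorem upperBranch_left_zero {x : ℂ} (hx : x ∈ edgeSet 0) : upperBranch 0 x ∈ edgeSet 1 := by
  obtain ⟨h1, h2⟩ := rootParam_of_left hx
  obtain ⟨e1, e2⟩ := squareOf_of_real h1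
  set a := (rootParam x).re
  have hd : 0 < a ^ 2 - a + 1 := by nlinarith
  have hpos : 0 < (squareOf (rootParam x)).re := by
    rw [e2]; exact div_pos (mul_pos (by norm_num) (pow_pos (by linarith) 2)) hd
  have hlt : (squareOf (rootParam x)).re < 1 := by
    rw [e2, div_lt_one hd]; nlinarith
  obtain ⟨g1, g2, g3⟩ := upperSqrt_of_pos e1 hpos
  refine ⟨g1, ?_, ?_⟩
  · exact lt_trans (by norm_num) g2
  · change (upperSqrt (squareOf (rootParam x))).re < 1
    nlinarith

/-- For real r, conjugation exchanges ωr and ω²r, so the two branches are mirror images in the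
imaginary axis. -/
theorem upperBranch_left_one {x : ℂ} (hx : x ∈ edgeSet 0) :
    upperBranch 1 x = -(starRingEnd ℂ) (upperBranch 2 x) := by
  obtain ⟨h1, -⟩ := rootParam_of_left hx
  have h : (starRingEnd ℂ) (branchParam x 1) = branchParam x 2 := by
    simp only [branchParam, map_mul, map_pow, star_omega]
    rw [Complex.conj_eq_iff_im.2 h1]
    linear_combination omega * rootParam x * omega_pow_three
  simp only [upperBranch, branchSquare]
  rw [← squareOf_star, h]

theorem upperBranch_mid_two {x : ℂ} (hx : x ∈ edgeSet 1) : upperBranch 2 x ∈ edgeSet 1 := by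
  obtain ⟨h1, h2⟩ := rootParam_of_mid hx
  have hs : (√3 : ℝ) * √3 = 3 := Real.mul_self_sqrt (by norm_num)
  have him : (branchParam x 2).im = 0 := by
    simp only [branchParam, Complex.mul_im, omega_re, omega_im, h1]; ring
  have hre : (branchParam x 2).re = -(2 * (rootParam x).re) := by
    simp only [branchParam, Complex.mul_re, omega_re, omega_im, h1]
    linear_combination -((rootParam x).re / 2) * hs
  obtain ⟨e1, e2⟩ := squareOf_of_real him
  rw [hre] at e2
  set a := (rootParam x).re
  have hd : 0 < (-(2 * a)) ^ 2 - -(2 * a) + 1 := by nlinarith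
  have hpos : 0 < (squareOf (branchParam x 2)).re := by
    rw [e2]; exact div_pos (mul_pos (by norm_num) (by nlinarith)) hd
  have hlt : (squareOf (branchParam x 2)).re < 1 := by
    rw [e2, div_lt_one hd]; nlinarith [mul_pos (sub_pos.2 h2) (sub_pos.2 h2)]
  obtain ⟨g1, g2, g3⟩ := upperSqrt_of_pos e1 hpos
  refine ⟨g1, ?_, ?_⟩
  · exact lt_trans (by norm_num) g2
  · change (upperSqrt (squareOf (branchParam x 2))).re < 1
    nlinarith

theorem upperBranch_mid_one {x : ℂ} (hx : x ∈ edgeSet 1) :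
    upperBranch 1 x = -(starRingEnd ℂ) (upperBranch 0 x) := by
  obtain ⟨h1, -⟩ := rootParam_of_mid hx
  have hs : (√3 : ℝ) * √3 = 3 := Real.mul_self_sqrt (by norm_num)
  have h : (starRingEnd ℂ) (branchParam x 1) = branchParam x 0 := by
    simp only [branchParam]
    apply Complex.ext
    · simp only [Complex.conj_re, Complex.mul_re, omega_sq_re, omega_sq_im, h1]
      linear_combination (rootParam x).re / 2 * hs
    · simp only [Complex.conj_im, Complex.mul_im, omega_sq_re, omega_sq_im, h1]
      ring
  simp only [upperBranch, branchSquare]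
  rw [← squareOf_star, h]

theorem rootParam_right_re {x : ℂ} (hx : x ∈ edgeSet 2) :
    1 / 2 < (rootParam x).re ∧ (rootParam x).re < 1 := by
  obtain ⟨h1, h2, h3⟩ := rootParam_of_right hx
  have hs : (√3 : ℝ) ^ 2 = 3 := Real.sq_sqrt (by norm_num)
  have hs0 : (0 : ℝ) < √3 := by positivity
  rw [Complex.normSq_apply] at h1
  have ha : 0 < (rootParam x).re := by
    by_contra! h
    nlinarith
  constructor
  · by_contra! h
    nlinarith [mul_self_lt_mul_self h2.le h3]
  · by_contra! h
    nlinarith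

/-- The square is negative, so the branch is purely imaginary and is its own mirror image. -/
theorem upperBranch_right_zero {x : ℂ} (hx : x ∈ edgeSet 2) :
    upperBranch 0 x = -(starRingEnd ℂ) (upperBranch 0 x) := by
  obtain ⟨h1, -⟩ := rootParam_of_right hx
  obtain ⟨h2, h3⟩ := rootParam_right_re hx
  obtain ⟨e1, e2⟩ := squareOf_of_circle h1 (by linarith)
  have hneg : (squareOf (rootParam x)).re < 0 := by
    rw [e2]; exact div_neg_of_neg_of_pos (by linarith) (by linarith)
  obtain ⟨g1, -⟩ := upperSqrt_of_neg e1 hneg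
  change upperSqrt (squareOf (rootParam x)) = -(starRingEnd ℂ) (upperSqrt (squareOf (rootParam x)))
  apply Complex.ext
  · simp [g1]
  · simp

theorem squareOf_circle_gt {r : ℂ} (h : Complex.normSq r = 1) (h1 : -1 < r.re)
    (h2 : r.re < 1 / 2) : (squareOf r).im = 0 ∧ 1 < (squareOf r).re := by
  obtain ⟨e1, e2⟩ := squareOf_of_circle h h2.ne
  refine ⟨e1, ?_⟩
  rw [e2, lt_div_iff_of_neg (by linarith)]
  linarith

theorem re_gt_neg_one {r : ℂ} (h : Complex.normSq r = 1) (h1 : r ^ 3 ≠ -1) : -1 < r.re := by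
  rw [Complex.normSq_apply] at h
  by_contra! h2
  have h3 : r.im = 0 := by nlinarith
  have h4 : r.re = -1 := by nlinarith
  refine h1 ?_
  rw [eq_ofReal_of_im_eq_zero h3, h4]
  norm_num

theorem upperBranch_right_two {x : ℂ} (hx : x ∈ edgeSet 2) : upperBranch 2 x ∈ edgeSet 2 := by
  obtain ⟨h1, h2, h3⟩ := rootParam_of_right hx
  obtain ⟨g1, -⟩ := rootParam_right_re hx
  have hs0 : (0 : ℝ) < √3 := by positivity
  have hn : Complex.normSq (branchParam x 2) = 1 := by rw [normSq_branchParam, h1]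
  obtain ⟨e1, e2⟩ := squareOf_circle_gt hn (re_gt_neg_one hn (by
      rw [branchParam_pow]; exact (rootParam_spec (edgeSet_subset hx)).2.2.2.2.1)) (by
    simp only [branchParam, Complex.mul_re, omega_re, omega_im]
    nlinarith)
  obtain ⟨k1, k2, k3⟩ := upperSqrt_of_pos e1 (by linarith)
  refine ⟨k1, ?_⟩
  change 1 < (upperSqrt (squareOf (branchParam x 2))).re
  nlinarith

theorem upperBranch_right_one {x : ℂ} (hx : x ∈ edgeSet 2) : upperBranch 1 x ∈ edgeSet 0 := by
  obtain ⟨h1, h2, h3⟩ := rootParam_of_right hx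
  obtain ⟨g1, -⟩ := rootParam_right_re hx
  have hs0 : (0 : ℝ) < √3 := by positivity
  have hs : (√3 : ℝ) * √3 = 3 := Real.mul_self_sqrt (by norm_num)
  have hn : Complex.normSq (branchParam x 1) = 1 := by rw [normSq_branchParam, h1]
  have hlt : (branchParam x 1).re < 1 / 2 := by
    simp only [branchParam, Complex.mul_re, omega_sq_re, omega_sq_im]
    rw [Complex.normSq_apply] at h1
    have h4 : √3 * (rootParam x).im < 1 + (rootParam x).re := by
      refine lt_of_pow_lt_pow_left₀ 2 (by linarith) ?_
      nlinarith
    linarith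
  obtain ⟨e1, e2⟩ := squareOf_circle_gt hn (re_gt_neg_one hn (by
      rw [branchParam_pow]; exact (rootParam_spec (edgeSet_subset hx)).2.2.2.2.1)) hlt
  have e : (starRingEnd ℂ) (squareOf (branchParam x 1)) = squareOf (branchParam x 1) :=
    Complex.conj_eq_iff_im.2 e1
  obtain ⟨k1, k2, k3⟩ := upperSqrt_of_pos e1 (by linarith)
  have e4 : upperBranch 1 x = -(starRingEnd ℂ) (upperSqrt (squareOf (branchParam x 1))) := by
    simp only [upperBranch, branchSquare, e]
  rw [e4]
  refine ⟨by simp [k1], ?_⟩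
  simp only [Complex.neg_re, Complex.conj_re]
  nlinarith

/-! ### Signed inverse branches on both half-planes -/

/-- The sign of a letter. -/
def signed (s : Bool) (z : ℂ) : ℂ := bif s then z else -z

/-- Complex conjugation on the lower side. -/
def reflected (ε : Bool) (z : ℂ) : ℂ := bif ε then z else (starRingEnd ℂ) z

theorem reflected_reflected (ε : Bool) (z : ℂ) : reflected ε (reflected ε z) = z := by
  cases ε <;> simp [reflected]

theorem continuous_reflected (ε : Bool) : Continuous (reflected ε) := by
  cases ε
  · exact Complex.continuous_conj
  · exact continuous_id

theorem continuous_signed (s : Bool) : Continuous (signed s) := by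
  cases s
  · exact continuous_neg
  · exact continuous_id

theorem reflected_of_im_eq_zero (ε : Bool) {z : ℂ} (h : z.im = 0) : reflected ε z = z := by
  cases ε
  · exact Complex.conj_eq_iff_im.2 h
  · rfl

theorem signed_sq (s : Bool) (z : ℂ) : signed s z ^ 2 = z ^ 2 := by
  cases s <;> simp [signed]

/-- The closed upper (`true`) or lower (`false`) half-plane without the postcritical points. -/
def closedSide (ε : Bool) : Set ℂ := {t | reflected ε t ∈ closedUpper}

/-- The half-plane that contains the image of a branch. -/
def sideOf (ε s : Bool) : Bool := bif s then ε else !ε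

/-- The inverse branches of `f₁` on both half-planes. -/
def branch (ε : Bool) (x : Letter) (t : ℂ) : ℂ :=
  reflected ε (signed x.1 (upperBranch x.2 (reflected ε t)))

theorem branch_mem {ε : Bool} {t : ℂ} (ht : t ∈ closedSide ε) (x : Letter) :
    branch ε x t ∈ closedSide (sideOf ε x.1) := by
  obtain ⟨h1, h2, h3⟩ := upperBranch_mem ht x.2
  have hr : ∀ z, reflected (sideOf ε x.1) (reflected ε z) = reflected x.1 z := by
    intro z
    cases ε <;> cases x.1 <;> simp [reflected, sideOf]
  rw [closedSide, Set.mem_ofPred_eq, branch, hr]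
  set u := upperBranch x.2 (reflected ε t)
  have hc : ∀ a : ℂ, (starRingEnd ℂ) (-u) = a → u = -(starRingEnd ℂ) a := by
    rintro _ rfl
    simp
  cases x.1
  · refine ⟨by simpa [reflected, signed] using h1, fun h => h3 ?_, fun h => h2 ?_⟩
    · simpa using hc _ h
    · simpa using hc _ h
  · exact ⟨h1, h2, h3⟩

theorem continuousOn_branch (ε : Bool) (x : Letter) :
    ContinuousOn (branch ε x) (closedSide ε) := by
  intro t ht
  refine ContinuousAt.continuousWithinAt ?_
  exact (continuous_reflected ε).continuousAt.comp ((continuous_signed x.1).continuousAt.comp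
    (ContinuousAt.comp (g := upperBranch x.2) (continuousAt_upperBranch ht x.2)
      (continuous_reflected ε).continuousAt))

theorem edgeSet_mem_closedSide {e : Fin 3} {x : ℂ} (hx : x ∈ edgeSet e) (ε : Bool) :
    x ∈ closedSide ε := by
  rw [closedSide, Set.mem_ofPred_eq, reflected_of_im_eq_zero ε (edgeSet_im hx)]
  exact edgeSet_subset hx

/-- Lower branches are conjugates of upper ones. A real boundary value therefore keeps its letter,
while a mirror pair exchanges indices and changes sign. -/
theorem branch_true_edge {e : Fin 3} {x : ℂ} (hx : x ∈ edgeSet e) (l : Letter) :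
    branch true l x = branch false (edgeLetter e l) x := by
  have hx0 := reflected_of_im_eq_zero false (edgeSet_im hx)
  have key : ∀ (s s' : Bool) (k k' : Fin 3),
      signed s (upperBranch k x) = (starRingEnd ℂ) (signed s' (upperBranch k' x)) →
      branch true (s, k) x = branch false (s', k') x := by
    intro s s' k k' h
    simp only [branch, hx0]
    exact h
  have hreal : ∀ (s : Bool) (k : Fin 3), (upperBranch k x).im = 0 →
      signed s (upperBranch k x) = (starRingEnd ℂ) (signed s (upperBranch k x)) := by
    intro s k h
    cases s
    · simp [signed, Complex.conj_eq_iff_im.2 h]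
    · exact (Complex.conj_eq_iff_im.2 h).symm
  have hcross : ∀ (s : Bool) (k k' : Fin 3),
      upperBranch k x = -(starRingEnd ℂ) (upperBranch k' x) →
      signed s (upperBranch k x) = (starRingEnd ℂ) (signed (!s) (upperBranch k' x)) := by
    intro s k k' h
    cases s <;> simp [signed, h]
  have hsymm : ∀ k k' : Fin 3, upperBranch k x = -(starRingEnd ℂ) (upperBranch k' x) →
      upperBranch k' x = -(starRingEnd ℂ) (upperBranch k x) := by
    intro k k' h
    rw [h]; simp
  obtain ⟨s, k⟩ := l
  fin_cases e <;> fin_cases k <;> refine key _ _ _ _ ?_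
  · exact hreal s 0 (upperBranch_left_zero hx).1
  · exact hcross s 1 2 (upperBranch_left_one hx)
  · exact hcross s 2 1 (hsymm _ _ (upperBranch_left_one hx))
  · exact hcross s 0 1 (hsymm _ _ (upperBranch_mid_one hx))
  · exact hcross s 1 0 (upperBranch_mid_one hx)
  · exact hreal s 2 (upperBranch_mid_two hx).1
  · exact hcross s 0 0 (upperBranch_right_zero hx)
  · exact hreal s 1 (upperBranch_right_one hx).1
  · exact hreal s 2 (upperBranch_right_two hx).1

theorem branch_edge {e : Fin 3} {x : ℂ} (hx : x ∈ edgeSet e) (ε : Bool) (l : Letter) :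
    branch ε l x = branch (!ε) (edgeLetter e l) x := by
  cases ε
  · have h := branch_true_edge hx (edgeLetter e l)
    rw [edgeLetter_edgeLetter] at h
    exact h.symm
  · exact branch_true_edge hx l

theorem branch_mem_edgeSet {e e' : Fin 3} {x : ℂ} (hx : x ∈ edgeSet e) (ε : Bool) {l : Letter}
    (h : edgeSection e l = some e') : branch ε l x ∈ edgeSet e' := by
  have key : ∀ (s : Bool) (k : Fin 3) (a : Fin 3), upperBranch k x ∈ edgeSet a →
      branch ε (s, k) x ∈ edgeSet (bif s then a else 2 - a) := by
    intro s k a ha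
    have : (signed s (upperBranch k x)) ∈ edgeSet (bif s then a else 2 - a) := by
      cases s
      · exact edgeSet_neg ha
      · exact ha
    simp only [branch, reflected_of_im_eq_zero ε (edgeSet_im hx)]
    rwa [reflected_of_im_eq_zero ε (edgeSet_im this)]
  obtain ⟨s, k⟩ := l
  fin_cases e <;> fin_cases k <;> cases s <;> simp [edgeSection] at h <;> subst h
  · exact key false 0 1 (upperBranch_left_zero hx)
  · exact key true 0 1 (upperBranch_left_zero hx)
  · exact key false 2 1 (upperBranch_mid_two hx)
  · exact key true 2 1 (upperBranch_mid_two hx)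
  · exact key false 1 0 (upperBranch_right_one hx)
  · exact key true 1 0 (upperBranch_right_one hx)
  · exact key false 2 2 (upperBranch_right_two hx)
  · exact key true 2 2 (upperBranch_right_two hx)

theorem sideOf_edgeLetter (e : Fin 3) (ε : Bool) (l : Letter) :
    sideOf (!ε) (edgeLetter e l).1 =
      bif (edgeSection e l).isSome then !(sideOf ε l.1) else sideOf ε l.1 := by
  revert e ε l; decide

/-! ### Labelling of the preimage tree -/

/-- The iterated preimage of `t` with label `w`, for `t` in the half-plane `ε`. -/
def vertexPoint : Bool → List Letter → ℂ → ℂ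
  | _, [], t => t
  | ε, l :: w, t => vertexPoint (sideOf ε l.1) w (branch ε l t)

theorem continuousOn_vertexPoint (ε : Bool) (w : List Letter) :
    ContinuousOn (vertexPoint ε w) (closedSide ε) := by
  induction w generalizing ε with
  | nil => exact continuousOn_id
  | cons l w ih => exact (ih _).comp (continuousOn_branch ε l) fun t ht => branch_mem ht l

/-- If the first branch sends the edge to an edge, the remaining word crosses that edge; otherwise
both descriptions continue in the same half-plane and the remaining word is unchanged. -/
theorem vertexPoint_edge {e : Fin 3} {x : ℂ} (hx : x ∈ edgeSet e) (ε : Bool) (w : List Letter) :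
    vertexPoint ε w x = vertexPoint (!ε) (crossEdge e w) x := by
  induction w generalizing e x ε with
  | nil => rfl
  | cons l w ih =>
    simp only [vertexPoint, crossEdge]
    rw [← branch_edge hx, sideOf_edgeLetter]
    cases h : edgeSection e l with
    | none => rfl
    | some e' => exact ih (branch_mem_edgeSet hx ε h) _

theorem f₁_eq_infty_iff (z : ℂ) :
    f₁ z = ∞ ↔ z ^ 2 * (z ^ 2 - 9 / 8) ^ 2 = 0 := by
  change (if _ then _ else _) = _ ↔ _
  split_ifs with h
  · simp [h]
  · simp [h]

theorem f₁_eq_coe_iff (z t : ℂ) :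
    f₁ z = (t : OnePoint ℂ) ↔ z ^ 2 * (z ^ 2 - 9 / 8) ^ 2 ≠ 0 ∧
      2 * (z ^ 2 - 3 / 4) ^ 3 = (t + 1) * (z ^ 2 * (z ^ 2 - 9 / 8) ^ 2) := by
  change (if _ then _ else _) = _ ↔ _
  split_ifs with h
  · simp [h]
  · rw [OnePoint.coe_eq_coe, sub_eq_iff_eq_add, div_eq_iff h]
    simp [h]

theorem f₁_infty : f₁ ∞ = ((1 : ℂ) : OnePoint ℂ) := rfl

theorem f₁_reflected {ε : Bool} {z t : ℂ} (h : f₁ z = (t : OnePoint ℂ)) :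
    f₁ (reflected ε z : ℂ) = (reflected ε t : ℂ) := by
  cases ε
  · rw [f₁_eq_coe_iff] at h ⊢
    have h1 : (starRingEnd ℂ) (z ^ 2 * (z ^ 2 - 9 / 8) ^ 2) =
        (starRingEnd ℂ) z ^ 2 * ((starRingEnd ℂ) z ^ 2 - 9 / 8) ^ 2 := by simp [map_ofNat]
    have h2 := congrArg (starRingEnd ℂ) h.2
    refine ⟨?_, ?_⟩
    · change (starRingEnd ℂ) z ^ 2 * ((starRingEnd ℂ) z ^ 2 - 9 / 8) ^ 2 ≠ 0
      rw [← h1]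
      exact (map_ne_zero _).2 h.1
    · simpa [map_ofNat, reflected] using h2
  · exact h

theorem f₁_branch {ε : Bool} {t : ℂ} (ht : t ∈ closedSide ε) (l : Letter) :
    f₁ (branch ε l t : ℂ) = (t : OnePoint ℂ) := by
  have h : f₁ (signed l.1 (upperBranch l.2 (reflected ε t)) : ℂ) =
      ((reflected ε t : ℂ) : OnePoint ℂ) := by
    rw [f₁_eq_coe_iff, signed_sq, upperBranch_sq]
    exact branchSquare_equation ht l.2
  have h' := f₁_reflected (ε := ε) h
  rwa [reflected_reflected] at h'

theorem exists_branch {ε : Bool} {t : ℂ} (ht : t ∈ closedSide ε) {q : OnePoint ℂ}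
    (hq : f₁ q = (t : OnePoint ℂ)) : ∃ l, q = (branch ε l t : ℂ) := by
  induction q using OnePoint.rec with
  | infty =>
    rw [f₁_infty, OnePoint.coe_eq_coe] at hq
    subst hq
    exact absurd (by cases ε <;> simp [reflected]) ht.2.1
  | coe z =>
    have h := ((f₁_eq_coe_iff _ _).1 (f₁_reflected (ε := ε) hq)).2
    obtain ⟨k, hk⟩ := exists_branchSquare ht h
    rw [← upperBranch_sq, sq_eq_sq_iff_eq_or_eq_neg] at hk
    rcases hk with hk | hk
    · refine ⟨(true, k), ?_⟩
      simp only [branch, signed, cond_true]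
      rw [← hk, reflected_reflected]
    · refine ⟨(false, k), ?_⟩
      simp only [branch, signed, cond_false]
      rw [← hk, reflected_reflected]

theorem branch_injective {ε : Bool} {t : ℂ} (ht : t ∈ closedSide ε) :
    Function.Injective fun l => branch ε l t := by
  rintro ⟨s, k⟩ ⟨s', k'⟩ h
  have h1 : signed s (upperBranch k (reflected ε t)) =
      signed s' (upperBranch k' (reflected ε t)) := by
    have := congrArg (reflected ε) h
    simpa only [branch, reflected_reflected] using this
  have h2 : k = k' := branchSquare_injective ht (by
    rw [← upperBranch_sq, ← upperBranch_sq, ← signed_sq s, h1, signed_sq])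
  subst h2
  have h0 : upperBranch k (reflected ε t) ≠ 0 := by
    intro h0
    have h3 := (mul_ne_zero_iff.1 (branchSquare_equation ht k).1).1
    rw [← upperBranch_sq, h0] at h3
    norm_num at h3
  cases s <;> cases s' <;> simp [signed, neg_eq_self, self_eq_neg, h0] at h1 ⊢

theorem iterate_vertexPoint {ε : Bool} {t : ℂ} (ht : t ∈ closedSide ε) (w : List Letter) :
    f₁^[w.length] (vertexPoint ε w t : ℂ) = (t : OnePoint ℂ) := by
  induction w generalizing ε t with
  | nil => rfl
  | cons l w ih =>
    rw [List.length_cons, Function.iterate_succ_apply', vertexPoint, ih (branch_mem ht l),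
      f₁_branch ht]

theorem exists_vertexPoint {ε : Bool} {t : ℂ} (ht : t ∈ closedSide ε) (n : ℕ) {p : OnePoint ℂ}
    (hp : f₁^[n] p = (t : OnePoint ℂ)) :
    ∃ w : List Letter, w.length = n ∧ (vertexPoint ε w t : OnePoint ℂ) = p := by
  induction n generalizing ε t with
  | zero => exact ⟨[], rfl, hp.symm⟩
  | succ n ih =>
    rw [Function.iterate_succ_apply'] at hp
    obtain ⟨l, hl⟩ := exists_branch ht hp
    obtain ⟨w, hw, hwp⟩ := ih (branch_mem ht l) hl
    exact ⟨l :: w, by simp [hw], hwp⟩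

theorem vertexPoint_injective {ε : Bool} {t : ℂ} (ht : t ∈ closedSide ε) {w w' : List Letter}
    (hlen : w.length = w'.length) (h : vertexPoint ε w t = vertexPoint ε w' t) : w = w' := by
  induction w generalizing ε t w' with
  | nil => exact (List.length_eq_zero_iff.1 hlen.symm).symm
  | cons l w ih =>
    cases w' with
    | nil => simp at hlen
    | cons l' w' =>
      have hl : w.length = w'.length := by simpa using hlen
      have h1 := iterate_vertexPoint (branch_mem ht l) w
      have h2 := iterate_vertexPoint (branch_mem ht l') w'
      simp only [vertexPoint] at h
      rw [h, hl, h2, OnePoint.coe_eq_coe] at h1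
      obtain rfl : l' = l := branch_injective ht h1
      rw [ih (branch_mem ht l') hl h]

/-- The labelling of the preimage tree by words. -/
def treeEquiv {ε : Bool} {t : ℂ} (ht : t ∈ closedSide ε) :
    List Letter ≃ PreimageTree f₁ (t : OnePoint ℂ) :=
  Equiv.ofBijective
    (fun w => ⟨(w.length, (vertexPoint ε w t : OnePoint ℂ)), iterate_vertexPoint ht w⟩) <| by
    constructor
    · intro w w' h
      have h' := congrArg Subtype.val h
      simp only [Prod.mk.injEq, OnePoint.coe_eq_coe] at h'
      exact vertexPoint_injective ht h'.1 h'.2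
    · rintro ⟨⟨n, p⟩, hp⟩
      obtain ⟨w, hw, hwp⟩ := exists_vertexPoint ht n hp
      exact ⟨w, Subtype.ext (Prod.ext hw hwp)⟩

/-! ### The postcritical set -/

/-- The points with parameters `r` and `omega * r` have the same image, and they tend to a preimage
of `-1` as `r` tends to `0`. -/
theorem mem_criticalSet_neg_one :
    ((upperSqrt (3 / 4) : ℂ) : OnePoint ℂ) ∈ criticalSet f₁ := by
  rintro ⟨U, hU, hinj⟩
  have hcont : ContinuousAt (fun r => upperSqrt (squareOf r)) 0 := by
    have h0 : squareOf 0 = 3 / 4 := by norm_num [squareOf]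
    refine ContinuousAt.comp (g := upperSqrt) (continuousAt_upperSqrt ?_ ?_) ?_
    · rw [h0]; norm_num
    · rw [h0]; norm_num
    · unfold squareOf
      exact ContinuousAt.div (by fun_prop) (by fun_prop) (by norm_num)
  have hval : upperSqrt (squareOf 0) = upperSqrt (3 / 4) := by norm_num [squareOf]
  have hV : ((↑) : ℂ → OnePoint ℂ) ⁻¹' U ∈ nhds (upperSqrt (squareOf 0)) := by
    rw [hval]
    exact OnePoint.continuous_coe.continuousAt hU
  have h1 : ∀ᶠ r in nhds (0 : ℂ), ((upperSqrt (squareOf r) : ℂ) : OnePoint ℂ) ∈ U := hcont hV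
  have hw : Filter.Tendsto (fun r : ℂ => omega * r) (nhds 0) (nhds 0) := by
    have : Continuous fun r : ℂ => omega * r := by fun_prop
    simpa using this.tendsto 0
  have h2 := hw.eventually h1
  have h3 : ∀ᶠ r in nhds (0 : ℂ), ‖r‖ < 1 := by
    have := Metric.ball_mem_nhds (0 : ℂ) one_pos
    filter_upwards [this] with r hr
    simpa using hr
  obtain ⟨r, ⟨⟨hr1, hr2⟩, hr3⟩, hr0⟩ := (((h1.and h2).and h3).filter_mono
    (nhdsWithin_le_nhds (s := {0}ᶜ))).and (self_mem_nhdsWithin (s := {(0 : ℂ)}ᶜ)) |>.exists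
  have hr0' : r ≠ 0 := hr0
  have hne : ∀ {z a : ℂ}, ‖z‖ < 1 → ‖a‖ = 1 → z ≠ a := by
    rintro z a hz ha rfl
    linarith
  have hp : ‖r ^ 3‖ < 1 := by
    rw [norm_pow]; exact pow_lt_one₀ (norm_nonneg _) hr3 three_ne_zero
  have e3 : (omega * r) ^ 3 = r ^ 3 := by rw [mul_pow, omega_pow_three, one_mul]
  have n1 : r ^ 3 ≠ 1 := hne hp (by simp)
  have n2 : r ^ 3 ≠ -1 := hne hp (by simp)
  have hdiff : squareOf r ≠ squareOf (omega * r) := by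
    refine squareOf_ne n2 (by rwa [e3]) ?_ ?_
    · intro h
      exact omega_ne_one (mul_right_cancel₀ hr0' (by rw [← h, one_mul]))
    · intro h
      have : r ^ 3 * r ^ 3 = 1 := by
        nth_rewrite 2 [← e3]
        rw [← mul_pow, h, one_pow]
      rcases mul_self_eq_one_iff.1 this with h | h
      · exact n1 h
      · exact n2 h
  set t : ℂ := -8 * r ^ 3 / (r ^ 3 - 1) ^ 2 - 1
  have ht : (t + 1) * (r ^ 3 - 1) ^ 2 = -8 * r ^ 3 := by
    rw [sub_add_cancel, div_mul_cancel₀]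
    exact pow_ne_zero _ (sub_ne_zero.2 n1)
  have f1 : f₁ (upperSqrt (squareOf r) : ℂ) = (t : OnePoint ℂ) := by
    rw [f₁_eq_coe_iff, upperSqrt_sq]
    exact squareOf_equation n1 n2 ht
  have f2 : f₁ (upperSqrt (squareOf (omega * r)) : ℂ) = (t : OnePoint ℂ) := by
    rw [f₁_eq_coe_iff, upperSqrt_sq]
    exact squareOf_equation (by rwa [e3]) (by rwa [e3]) (by rwa [e3])
  have h := OnePoint.coe_injective (hinj hr1 hr2 (f1.trans f2.symm))
  refine hdiff ?_
  rw [← upperSqrt_sq (squareOf r), h, upperSqrt_sq]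

theorem mem_criticalSet_zero : ((0 : ℂ) : OnePoint ℂ) ∈ criticalSet f₁ := by
  rintro ⟨U, hU, hinj⟩
  have hV : ((↑) : ℂ → OnePoint ℂ) ⁻¹' U ∈ nhds (0 : ℂ) :=
    OnePoint.continuous_coe.continuousAt hU
  have hneg : Filter.Tendsto (fun r : ℂ => -r) (nhds 0) (nhds 0) := by
    simpa using (continuous_neg (G := ℂ)).tendsto 0
  have h1 : ∀ᶠ r in nhds (0 : ℂ), ((r : ℂ) : OnePoint ℂ) ∈ U := hV
  obtain ⟨r, ⟨hr1, hr2⟩, hr0⟩ := ((h1.and (hneg.eventually h1)).filter_mono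
    (nhdsWithin_le_nhds (s := {0}ᶜ))).and (self_mem_nhdsWithin (s := {(0 : ℂ)}ᶜ)) |>.exists
  have hf : f₁ (r : ℂ) = f₁ (-r : ℂ) := by
    change (if _ then _ else _) = (if _ then _ else _)
    simp only [neg_sq]
  have h := OnePoint.coe_injective (hinj hr1 hr2 hf)
  exact hr0 (self_eq_neg.1 h)

/-- The numerator of the derivative is -(27/8) z (z² - 3/4)² (z² - 9/8), nonzero here, and the
inverse function theorem gives local injectivity. -/
theorem notMem_criticalSet {z : ℂ} (hD : z ^ 2 * (z ^ 2 - 9 / 8) ^ 2 ≠ 0)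
    (hN : z ^ 2 - 3 / 4 ≠ 0) : (z : OnePoint ℂ) ∉ criticalSet f₁ := by
  rw [criticalSet, Set.mem_ofPred_eq, not_not]
  set F : ℂ → ℂ := fun z => 2 * (z ^ 2 - 3 / 4) ^ 3 / (z ^ 2 * (z ^ 2 - 9 / 8) ^ 2) - 1 with hF
  obtain ⟨h0, h9⟩ := mul_ne_zero_iff.1 hD
  have h0 : z ≠ 0 := fun h => h0 (by rw [h]; norm_num)
  have h9 : z ^ 2 - 9 / 8 ≠ 0 := fun h => h9 (by rw [h]; norm_num)
  have d2 : HasStrictDerivAt (fun z : ℂ => z ^ 2) (2 * z) z := by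
    simpa using hasStrictDerivAt_pow 2 z
  have d3 : HasStrictDerivAt (fun z : ℂ => z ^ 2 - 3 / 4) (2 * z) z := d2.sub_const _
  have d9 : HasStrictDerivAt (fun z : ℂ => z ^ 2 - 9 / 8) (2 * z) z := d2.sub_const _
  have dN := (d3.pow 3).const_mul 2
  have dD := d2.mul (d9.pow 2)
  have dF := (dN.div dD hD).sub_const 1
  have hne : (2 * (((3 : ℕ) : ℂ) * (z ^ 2 - 3 / 4) ^ (3 - 1) * (2 * z)) *
      (z ^ 2 * (z ^ 2 - 9 / 8) ^ 2) - 2 * (z ^ 2 - 3 / 4) ^ 3 *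
      (2 * z * (z ^ 2 - 9 / 8) ^ 2 +
        z ^ 2 * (((2 : ℕ) : ℂ) * (z ^ 2 - 9 / 8) ^ (2 - 1) * (2 * z)))) /
      (z ^ 2 * (z ^ 2 - 9 / 8) ^ 2) ^ 2 ≠ 0 := by
    refine div_ne_zero ?_ (pow_ne_zero _ hD)
    have e : 2 * (((3 : ℕ) : ℂ) * (z ^ 2 - 3 / 4) ^ (3 - 1) * (2 * z)) *
      (z ^ 2 * (z ^ 2 - 9 / 8) ^ 2) - 2 * (z ^ 2 - 3 / 4) ^ 3 *
      (2 * z * (z ^ 2 - 9 / 8) ^ 2 + z ^ 2 * (((2 : ℕ) : ℂ) * (z ^ 2 - 9 / 8) ^ (2 - 1) * (2 * z)))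
      = -(27 / 8) * (z * (z ^ 2 - 3 / 4) ^ 2 * (z ^ 2 - 9 / 8)) := by
      norm_num; ring
    rw [e]
    exact mul_ne_zero (by norm_num) (mul_ne_zero (mul_ne_zero h0 (pow_ne_zero _ hN)) h9)
  have hstrict : HasStrictDerivAt F _ z := dF
  obtain ⟨V, hV, hVinj⟩ : ∃ V ∈ nhds z, Set.InjOn F V := by
    have h := hstrict.hasStrictFDerivAt_equiv hne
    exact ⟨_, h.toOpenPartialHomeomorph F |>.open_source.mem_nhds
      h.mem_toOpenPartialHomeomorph_source, (h.toOpenPartialHomeomorph F).injOn⟩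
  have hW : {z : ℂ | z ^ 2 * (z ^ 2 - 9 / 8) ^ 2 ≠ 0} ∈ nhds z :=
    (isOpen_ne_fun (by fun_prop) continuous_const).mem_nhds hD
  refine ⟨((↑) : ℂ → OnePoint ℂ) '' (V ∩ {z : ℂ | z ^ 2 * (z ^ 2 - 9 / 8) ^ 2 ≠ 0}), ?_, ?_⟩
  · rw [OnePoint.nhds_coe_eq]
    exact Filter.image_mem_map (Filter.inter_mem hV hW)
  · have hval : ∀ x : ℂ, x ^ 2 * (x ^ 2 - 9 / 8) ^ 2 ≠ 0 → f₁ x = (F x : OnePoint ℂ) := by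
      intro x hx
      exact if_neg hx
    rintro _ ⟨x, ⟨hxV, hx⟩, rfl⟩ _ ⟨y, ⟨hyV, hy⟩, rfl⟩ hxy
    rw [hval x hx, hval y hy, OnePoint.coe_eq_coe] at hxy
    rw [hVinj hxV hyV hxy]

theorem f₁_neg_one : f₁ ((-1 : ℂ) : OnePoint ℂ) = ((1 : ℂ) : OnePoint ℂ) := by
  rw [f₁_eq_coe_iff]; norm_num

theorem f₁_one : f₁ ((1 : ℂ) : OnePoint ℂ) = ((1 : ℂ) : OnePoint ℂ) := by
  rw [f₁_eq_coe_iff]; norm_num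

/-- For the upper bound it is irrelevant whether ∞ and the poles are critical, since their images
already lie in the set, which is forward invariant. -/
theorem postcriticalSet_f₁ :
    postcriticalSet f₁ = {((1 : ℂ) : OnePoint ℂ), ((-1 : ℂ) : OnePoint ℂ), ∞} := by
  have hcrit : f₁ (upperSqrt (3 / 4) : ℂ) = ((-1 : ℂ) : OnePoint ℂ) := by
    rw [f₁_eq_coe_iff, upperSqrt_sq]; norm_num
  have hzero : f₁ ((0 : ℂ) : OnePoint ℂ) = ∞ := by rw [f₁_eq_infty_iff]; norm_num
  apply Set.Subset.antisymm
  · have hstep : ∀ x ∈ criticalSet f₁,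
        f₁ x ∈ ({((1 : ℂ) : OnePoint ℂ), ((-1 : ℂ) : OnePoint ℂ), ∞} : Set (OnePoint ℂ)) := by
      intro x hx
      induction x using OnePoint.rec with
      | infty => exact Or.inl f₁_infty
      | coe z =>
        by_cases hD : z ^ 2 * (z ^ 2 - 9 / 8) ^ 2 = 0
        · exact Or.inr (Or.inr ((f₁_eq_infty_iff z).2 hD))
        · by_cases hN : z ^ 2 - 3 / 4 = 0
          · refine Or.inr (Or.inl ((f₁_eq_coe_iff _ _).2 ⟨hD, ?_⟩))
            rw [hN]; ring
          · exact absurd hx (notMem_criticalSet hD hN)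
    have hinv : ∀ x ∈ ({((1 : ℂ) : OnePoint ℂ), ((-1 : ℂ) : OnePoint ℂ), ∞} : Set (OnePoint ℂ)),
        f₁ x ∈ ({((1 : ℂ) : OnePoint ℂ), ((-1 : ℂ) : OnePoint ℂ), ∞} : Set (OnePoint ℂ)) := by
      rintro x (rfl | rfl | rfl)
      · exact Or.inl f₁_one
      · exact Or.inl f₁_neg_one
      · exact Or.inl f₁_infty
    refine Set.iUnion_subset fun n => ?_
    rintro _ ⟨x, hx, rfl⟩
    induction n with
    | zero => exact hstep x hx
    | succ n ih =>
      rw [Function.iterate_succ_apply']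
      exact hinv _ ih
  · rintro x (rfl | rfl | rfl)
    -- Index 1 denotes the second iterate: the critical point goes to -1 and then to 1.
    · refine Set.mem_iUnion.2 ⟨1, _, mem_criticalSet_neg_one, ?_⟩
      change f₁ (f₁ _) = _
      rw [hcrit, f₁_neg_one]
    · exact Set.mem_iUnion.2 ⟨0, _, mem_criticalSet_neg_one, hcrit⟩
    · exact Set.mem_iUnion.2 ⟨0, _, mem_criticalSet_zero, hzero⟩

/-! ### Monodromy -/

theorem reflected_eq_iff (ε : Bool) (z a : ℂ) (ha : a.im = 0) : reflected ε z = a ↔ z = a := by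
  constructor
  · intro h
    rw [← reflected_reflected ε z, h, reflected_of_im_eq_zero ε ha]
  · rintro rfl
    exact reflected_of_im_eq_zero ε ha

theorem notMem_postcriticalSet {ε : Bool} {t : ℂ} (ht : t ∈ closedSide ε) :
    (t : OnePoint ℂ) ∉ postcriticalSet f₁ := by
  obtain ⟨-, h1, h2⟩ := ht
  rw [postcriticalSet_f₁]
  rintro (h | h | h)
  · exact h1 ((reflected_eq_iff ε t 1 (by simp)).2 (OnePoint.coe_injective h))
  · exact h2 ((reflected_eq_iff ε t (-1) (by simp)).2 (OnePoint.coe_injective h))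
  · exact OnePoint.coe_ne_infty _ h

/-- The closed upper half-plane without ±1 is star-shaped about i. -/
theorem joinedIn_closedSide {ε : Bool} {x y : ℂ} (hx : x ∈ closedSide ε) (hy : y ∈ closedSide ε) :
    JoinedIn (closedSide ε) x y := by
  have key : ∀ x ∈ closedUpper, JoinedIn closedUpper x Complex.I := by
    intro x hx
    refine JoinedIn.of_segment_subset ?_
    rintro _ ⟨a, b, ha, hb, hab, rfl⟩
    rcases hb.eq_or_lt with rfl | hb
    · obtain rfl : a = 1 := by linarith
      simpa using hx
    · have h : 0 < (a • x + b • Complex.I).im := by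
        have := mul_nonneg ha hx.1
        simp; linarith
      exact ⟨h.le, fun e => by rw [e] at h; simp at h, fun e => by rw [e] at h; simp at h⟩
  have h := (key _ hx).trans (key _ hy).symm
  obtain ⟨γ, hγ⟩ := h
  refine ⟨(γ.map (continuous_reflected ε)).cast (reflected_reflected ε x).symm
    (reflected_reflected ε y).symm, fun s => ?_⟩
  change reflected ε (reflected ε (γ s)) ∈ closedUpper
  rw [reflected_reflected]
  exact hγ s

/-- Some path from `x` to `y` off the postcritical set lifts to paths between the vertices with
labels `w` and `p w`. -/
def Transports (ε ε' : Bool) (x y : ℂ) (p : List Letter → List Letter) : Prop :=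
  ∃ γ : Path (x : OnePoint ℂ) (y : OnePoint ℂ), (∀ s, γ s ∉ postcriticalSet f₁) ∧
    ∀ w, (p w).length = w.length ∧
      ∃ δ : Path (vertexPoint ε w x : OnePoint ℂ) (vertexPoint ε' (p w) y : OnePoint ℂ),
        ∀ s, f₁^[w.length] (δ s) = γ s

theorem Transports.trans {ε ε' ε'' : Bool} {x y z : ℂ} {p q : List Letter → List Letter}
    (hp : Transports ε ε' x y p) (hq : Transports ε' ε'' y z q) :
    Transports ε ε'' x z (q ∘ p) := by
  obtain ⟨γ, hγ, hp⟩ := hp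
  obtain ⟨η, hη, hq⟩ := hq
  refine ⟨γ.trans η, fun s => ?_, fun w => ?_⟩
  · rw [Path.trans_apply]
    split_ifs
    · exact hγ _
    · exact hη _
  · obtain ⟨e₁, δ₁, h₁⟩ := hp w
    obtain ⟨e₂, δ₂, h₂⟩ := hq (p w)
    refine ⟨e₂.trans e₁, δ₁.trans δ₂, fun s => ?_⟩
    rw [Path.trans_apply, Path.trans_apply]
    split_ifs
    · exact h₁ _
    · rw [← e₁]
      exact h₂ _

theorem transports_id {ε : Bool} {x y : ℂ} (hx : x ∈ closedSide ε) (hy : y ∈ closedSide ε) :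
    Transports ε ε x y id := by
  obtain ⟨γ, hγ⟩ := joinedIn_closedSide hx hy
  refine ⟨γ.map OnePoint.continuous_coe, fun s => notMem_postcriticalSet (hγ s), fun w =>
    ⟨rfl, ?_⟩⟩
  have hc : ContinuousOn (vertexPoint ε w) (Set.range γ) :=
    (continuousOn_vertexPoint ε w).mono (Set.range_subset_iff.2 hγ)
  exact ⟨(γ.map' hc).map OnePoint.continuous_coe, fun s => iterate_vertexPoint (hγ s) w⟩

theorem length_crossEdge (e : Fin 3) (w : List Letter) : (crossEdge e w).length = w.length := by
  induction w generalizing e with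
  | nil => rfl
  | cons l w ih =>
    simp only [crossEdge, List.length_cons]
    cases edgeSection e l with
    | none => rfl
    | some e' => rw [ih]

/-- A constant path suffices: at a point of the edge, the same vertices carry two labels. -/
theorem transports_crossEdge {e : Fin 3} {x : ℂ} (hx : x ∈ edgeSet e) (ε : Bool) :
    Transports ε (!ε) x x (crossEdge e) := by
  have hm := edgeSet_mem_closedSide hx ε
  refine ⟨Path.refl _, fun _ => notMem_postcriticalSet hm, fun w => ⟨length_crossEdge e w, ?_⟩⟩
  rw [← vertexPoint_edge hx]
  exact ⟨Path.refl _, fun _ => iterate_vertexPoint hm w⟩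

theorem exists_mem_edgeSet (e : Fin 3) : ∃ x, x ∈ edgeSet e := by
  fin_cases e
  · exact ⟨-2, by norm_num [edgeSet]⟩
  · exact ⟨0, by norm_num [edgeSet]⟩
  · exact ⟨2, by norm_num [edgeSet]⟩

/-- The loop goes to the edge `e'`, crosses it, returns through `e` and ends at t; labels change
only at the two crossings. -/
theorem transports_rotation {ε : Bool} {t : ℂ} (ht : t ∈ closedSide ε) (e e' : Fin 3) :
    Transports ε ε t t (reflection e * reflection e') := by
  obtain ⟨x, hx⟩ := exists_mem_edgeSet e
  obtain ⟨x', hx'⟩ := exists_mem_edgeSet e'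
  have h := (((transports_id ht (edgeSet_mem_closedSide hx' ε)).trans
    (transports_crossEdge hx' ε)).trans (transports_id (edgeSet_mem_closedSide hx' (!ε))
    (edgeSet_mem_closedSide hx (!ε)))).trans (transports_crossEdge hx (!ε))
  rw [Bool.not_not] at h
  exact h.trans (transports_id (edgeSet_mem_closedSide hx ε) ht)

theorem rotationGroup_le_comap_IMG {ε : Bool} {t : ℂ} (ht : t ∈ closedSide ε) :
    rotationGroup ≤ (IMG f₁ (t : OnePoint ℂ) (notMem_postcriticalSet ht)).comap
      (treeEquiv ht).permCongrHom.toMonoidHom := by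
  refine (Subgroup.closure_le _).2 ?_
  rintro _ ⟨e, e', rfl⟩
  obtain ⟨γ, hγ, h⟩ := transports_rotation ht e e'
  refine ⟨γ, hγ, fun v => ?_⟩
  obtain ⟨w, rfl⟩ := (treeEquiv ht).surjective v
  obtain ⟨hlen, hδ⟩ := h w
  have he : (treeEquiv ht).permCongrHom.toMonoidHom (reflection e * reflection e')
      (treeEquiv ht w) = treeEquiv ht ((reflection e * reflection e') w) := by
    change (treeEquiv ht) ((reflection e * reflection e') ((treeEquiv ht).symm _)) = _
    rw [Equiv.symm_apply_apply]
  rw [he]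
  exact ⟨hlen, hδ⟩

theorem exists_closedSide {t : OnePoint ℂ} (ht : t ∉ postcriticalSet f₁) :
    ∃ (ε : Bool) (z : ℂ), z ∈ closedSide ε ∧ t = (z : OnePoint ℂ) := by
  rw [postcriticalSet_f₁] at ht
  induction t using OnePoint.rec with
  | infty => simp at ht
  | coe z =>
    have h1 : z ≠ 1 := fun h => ht (Or.inl (by rw [h]))
    have h2 : z ≠ -1 := fun h => ht (Or.inr (Or.inl (by rw [h])))
    have key : ∀ ε, 0 ≤ (reflected ε z).im → z ∈ closedSide ε := fun ε h =>
      ⟨h, fun h' => h1 ((reflected_eq_iff ε z 1 (by simp)).1 h'),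
        fun h' => h2 ((reflected_eq_iff ε z (-1) (by simp)).1 h')⟩
    rcases le_total 0 z.im with h | h
    · exact ⟨true, z, key true h, rfl⟩
    · exact ⟨false, z, key false (by simpa [reflected] using h), rfl⟩


end

theorem mainTheorem10 (t : OnePoint ℂ) (ht : t ∉ postcriticalSet f₁) (n : ℕ) :
    ∃ A : Subgroup (IMG f₁ t ht), Nonempty (A ≃* Multiplicative (Fin n → ℤ)) := by
  obtain ⟨ε, z, hz, rfl⟩ := exists_closedSide ht
  -- Level 0 of the rigid groups is `rotationGroup` itself.
  obtain ⟨φ, hφ, hm⟩ := exists_free_abelian n 0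
  let ψ := (((treeEquiv hz).permCongrHom.toMonoidHom.comp φ).codRestrict (IMG f₁ z ht)
    fun k => rotationGroup_le_comap_IMG hz (hm k))
  have hψ : Function.Injective ψ := by
    intro k l h
    exact hφ ((treeEquiv hz).permCongrHom.injective (congrArg Subtype.val h))
  exact ⟨ψ.range, ⟨(MonoidHom.ofInjective hψ).symm⟩⟩
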